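/- Let $d,\alpha\ge 1$ be integers, let $\sigma\in\mathbb N$ with $\sigma>d/2$, and put $p=1+2\alpha$. Let $\gamma_+,\gamma_->0$, $t_+\in(0,1)$, and let $\gamma:\mathbb R\to\mathbb R$ be the $1$-periodic function with $\gamma=\gamma_+$ on $(0,t_+]$ and $\gamma=-\gamma_-$ on $(t_+,1]$; write $\langle\gamma\rangle=\int_0^1\gamma(\tau)\,d\tau$. Let $t_0\in\mathbb R$ and $\varphi\in H^\sigma(\mathbb R^d)$ (complex valued). Consider, for $\varepsilon>0$, the dispersion managed equation $$ i\partial_t u_\varepsilon+\gamma\!\left(\tfrac t\varepsilon\right)\Delta u_\varepsilon+|u_\varepsilon|^{p-1}u_\varepsilon=0,\qquad u_\varepsilon(t_0)=\varphi, $$ and the averaged equation $$ i\partial_t u_0+\langle\gamma\rangle\Delta u_0+|u_0|^{p-1}u_0=0,\qquad u_0(t_0)=\varphi. $$ For $g(t)=\gamma(t/\varepsilon)$ or $g(t)=\langle\gamma\rangle$, an $H^\sigma$ solution on an interval $J$ with left end point $t_0\in J$ is a function $u\in C(J,H^\sigma(\mathbb R^d))$ with $$u(t)=U(t,t_0)\varphi+i\int_{t_0}^tU(t,s)\,|u(s)|^{p-1}u(s)\,ds\quad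 (t\in J),\qquad U(t,s)=e^{i\left(\int_s^t g(\tau)\,d\tau\right)\Delta}.$$ A maximal solution is an $H^\sigma$ solution on $[t_0,T_{\max})$, $t_0<T_{\max}\le\infty$, such that $\lim_{t\uparrow T_{\max}}\|u(t)\|_{H^\sigma}=\infty$ if $T_{\max}<\infty$. Then the averaged equation and, for every $\varepsilon>0$, the dispersion managed equation have a maximal solution, and it is unique in the sense that every $H^\sigma$ solution on a compact interval $[t_0,T]$, $T>t_0$, satisfies $T<T_{\max}$ and is the restriction of the maximal solution. Let $u_0$ on $[t_0,T_*)$ and $u_\varepsilon$ on $[t_0,T^\varepsilon)$ denote these maximal solutions. For every $T$ with $t_0<T<T_*$ one has $T<T^\varepsilon$ for all sufficiently small $\varepsilon>0$, and $$\lim_{\varepsilon\to0_+}\ \sup_{t\in[t_0,T]}\|u_\varepsilon(t)-u_0(t)\|_{H^\sigma(\mathbb R^d)}=0,$$ that is, $u_\varepsilon\to u_0$ in $L^\infty([t_0,T],H^\sigma(\mathbb R^d))$ as $\varepsilon\to0_+$. -/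

import Mathlib

open MeasureTheory Filter Topology Set FourierTransform
open scoped ENNReal SchwartzMap

noncomputable section

/-- The space `L²(ℝᵈ; ℂ)`. -/
abbrev L2 (d : ℕ) : Type :=
  Lp ℂ 2 (volume : Measure (EuclideanSpace ℝ (Fin d)))

/-- `f ∈ L²(ℝᵈ)` belongs to the Sobolev space `H^s(ℝᵈ)`. -/
def MemHs {d : ℕ} (s : ℝ) (f : L2 d) : Prop :=
  TemperedDistribution.MemSobolev s 2 (f : 𝓢'(EuclideanSpace ℝ (Fin d), ℂ))

/-- The Sobolev norm `‖f‖_{H^s} = (∫ (1 + 4π²|ξ|²)^s |𝓕 f(ξ)|² dξ)^{1/2}`, with value `∞` for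
`f ∉ H^s`. As `𝓕 f(ξ) = ∫ e^{-2πi x·ξ} f(x) dx`, the weight is the symbol of `(1 - Δ)^{s/2}`. -/
def hsNorm {d : ℕ} (s : ℝ) (f : L2 d) : ℝ≥0∞ :=
  eLpNorm (fun ξ : EuclideanSpace ℝ (Fin d) =>
    (((1 + 4 * Real.pi ^ 2 * ‖ξ‖ ^ 2) ^ (s / 2) : ℝ) : ℂ) * (𝓕 f : L2 d) ξ) 2 volume

/-- The symbol of `e^{iθΔ}`, as a bounded function. -/
theorem memLp_schrodingerSymbol (d : ℕ) (θ : ℝ) :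
    MemLp (fun ξ : EuclideanSpace ℝ (Fin d) =>
      Complex.exp (-(Complex.I * ((θ * (4 * Real.pi ^ 2 * ‖ξ‖ ^ 2) : ℝ) : ℂ)))) ∞ volume := by
  refine memLp_top_of_bound (Continuous.aestronglyMeasurable (by fun_prop)) 1
    (Eventually.of_forall fun ξ => ?_)
  simp only [Complex.norm_exp, Complex.neg_re, Complex.I_mul_re, Complex.ofReal_im, neg_zero,
    Real.exp_zero, le_refl]

/-- The unitary operator `e^{iθΔ}` on `L²(ℝᵈ)`, i.e. the Fourier multiplier
`e^{-iθ·4π²|ξ|²}`. -/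
def schrodingerOp {d : ℕ} (θ : ℝ) (f : L2 d) : L2 d :=
  𝓕⁻ ((memLp_schrodingerSymbol d θ).toLp _ • (𝓕 f : L2 d) : L2 d)

open Classical in
/-- The nonlinearity `|u|^{p-1} u` with `p = 1 + 2α`, as a map into `L²`. It is given the value `0`
if `|u|^{2α} u` is not in `L²`, which does not occur for `u ∈ H^σ` with `σ > d/2`. -/
def powerNL {d : ℕ} (α : ℕ) (u : L2 d) : L2 d :=
  if h : MemLp (fun x => ((‖u x‖ ^ (2 * α) : ℝ) : ℂ) * u x) 2
      (volume : Measure (EuclideanSpace ℝ (Fin d))) then h.toLp _ else 0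

/-- The `1`-periodic dispersion map with value `γp` on `(0, tp]` and `-γm` on `(tp, 1]`; here
`τ - ⌈τ⌉ + 1` is the representative of `τ` modulo `1` in `(0, 1]`. -/
def dispersionMap (γp γm tp τ : ℝ) : ℝ :=
  if τ - ⌈τ⌉ + 1 ≤ tp then γp else -γm

/-- The average `⟨γ⟩ = ∫₀¹ γ(τ) dτ`. -/
def averageDispersion (γ : ℝ → ℝ) : ℝ := ∫ τ in (0 : ℝ)..1, γ τ

/-- `u` is an `H^σ` solution on the time interval `J` (with left end point `t₀`) of
`i ∂ₜu + g(t) Δu + |u|^{2α} u = 0`, `u(t₀) = φ`: it is continuous on `J` with values in `H^σ` and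
satisfies Duhamel's formula
`u(t) = U(t,t₀) φ + i ∫_{t₀}^t U(t,s) |u(s)|^{2α} u(s) ds` with `U(t,s) = exp(i (∫_s^t g) Δ)`. -/
structure IsNLSSolution {d : ℕ} (σ α : ℕ) (g : ℝ → ℝ) (t₀ : ℝ) (φ : L2 d) (J : Set ℝ)
    (u : ℝ → L2 d) : Prop where
  mem : ∀ t ∈ J, MemHs σ (u t)
  cont : ∀ t ∈ J, Tendsto (fun s => hsNorm σ (u s - u t)) (𝓝[J] t) (𝓝 0)
  duhamel : ∀ t ∈ J, u t = schrodingerOp (∫ τ in t₀..t, g τ) φ +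
    Complex.I • ∫ s in t₀..t, schrodingerOp (∫ τ in s..t, g τ) (powerNL α (u s))

/-- `u` is a maximal `H^σ` solution, with existence interval `[t₀, Tmax)`: if `Tmax < ∞`, then
`‖u(t)‖_{H^σ} → ∞` as `t ↑ Tmax`. -/
structure IsMaximalNLSSolution {d : ℕ} (σ α : ℕ) (g : ℝ → ℝ) (t₀ : ℝ) (φ : L2 d)
    (Tmax : EReal) (u : ℝ → L2 d) : Prop where
  lt : (t₀ : EReal) < Tmax
  isSolution : IsNLSSolution σ α g t₀ φ {t : ℝ | t₀ ≤ t ∧ (t : EReal) < Tmax} u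
  blowup : ∀ T : ℝ, Tmax = (T : EReal) → Tendsto (fun t => hsNorm σ (u t)) (𝓝[<] T) (𝓝 ∞)

/-- There is a maximal `H^σ` solution, and every `H^σ` solution on a compact interval `[t₀, T]` is
a restriction of it. In particular its `Tmax` is the maximal time of existence in `H^σ`. -/
def HasUniqueMaximalNLSSolution {d : ℕ} (σ α : ℕ) (g : ℝ → ℝ) (t₀ : ℝ) (φ : L2 d) : Prop :=
  ∃ (Tmax : EReal) (u : ℝ → L2 d), IsMaximalNLSSolution σ α g t₀ φ Tmax u ∧
    ∀ (T : ℝ) (v : ℝ → L2 d), t₀ < T → IsNLSSolution σ α g t₀ φ (Icc t₀ T) v →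
      (T : EReal) < Tmax ∧ EqOn v u (Icc t₀ T)

end

/-!
In the interaction picture `b(t) = e^{-iθ(t)Δ} u(t)`, where `θ(t) = ∫_{t₀}^t g` is the accumulated
dispersion, Duhamel's formula becomes an ordinary differential equation for `b` whose vector field
depends on `g` only through `θ(t)`. For `σ > d/2` the space `H^σ` is an algebra, so this field is
Lipschitz on balls, uniformly in `θ` because `e^{iθΔ}` is an isometry, and maximal solutions exist.
As `γ - ⟨γ⟩` has mean zero over a period, its primitive is bounded, so the accumulated dispersions
of `γ(t/ε)` converge to that of `⟨γ⟩` uniformly at rate `ε`. The group `e^{iθΔ}` is only strongly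
continuous, hence the two fields are compared along the single averaged solution, on which the
convergence is uniform by compactness; Grönwall's inequality carries it over to the solutions, and
a bootstrap shows that the perturbed ones exist up to time `T`.
-/

section IntegralEquations

open Metric
open scoped NNReal

variable {X : Type*} [NormedAddCommGroup X] [NormedSpace ℝ X]

/-- `b` is continuous on `J` and satisfies there the integral form of the initial value problem
`b' = F t b`, `b t₀ = x₀`. -/
structure IsIntegralSolution (F : ℝ → X → X) (t₀ : ℝ) (x₀ : X) (J : Set ℝ) (b : ℝ → X) :
    Prop where
  continuousOn : ContinuousOn b J
  eqOn_picard : EqOn b (ODE.picard F t₀ x₀ b) J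

/-- A jointly continuous time-dependent field, bounded and Lipschitz on balls uniformly in time:
the setting in which solutions live at least for a time depending only on the size of the data. -/
structure IsUniformLipschitzField (F : ℝ → X → X) : Prop where
  continuous : Continuous (Function.uncurry F)
  lipschitzOnWith : ∀ R : ℝ, ∃ K : ℝ≥0, ∀ t, LipschitzOnWith K (F t) (closedBall 0 R)
  norm_le : ∀ R : ℝ, ∃ C : ℝ≥0, ∀ t, ∀ x ∈ closedBall (0 : X) R, ‖F t x‖ ≤ C

namespace IsIntegralSolution

variable {F : ℝ → X → X} {t₀ t₁ T : ℝ} {x₀ : X} {J J' : Set ℝ} {b c : ℝ → X}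

theorem mono (h : IsIntegralSolution F t₀ x₀ J b) (hJ : J' ⊆ J) :
    IsIntegralSolution F t₀ x₀ J' b :=
  ⟨h.continuousOn.mono hJ, h.eqOn_picard.mono hJ⟩

theorem mono_right (h : IsIntegralSolution F t₀ x₀ (Icc t₀ T) b) (ht₁ : t₁ ≤ T) :
    IsIntegralSolution F t₀ x₀ (Icc t₀ t₁) b :=
  h.mono (Icc_subset_Icc_right ht₁)

theorem apply_left (h : IsIntegralSolution F t₀ x₀ J b) (ht : t₀ ∈ J) : b t₀ = x₀ := by
  simpa using h.eqOn_picard ht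

theorem const (F : ℝ → X → X) (t₀ : ℝ) (x₀ : X) :
    IsIntegralSolution F t₀ x₀ (Icc t₀ t₀) fun _ => x₀ :=
  ⟨continuousOn_const, fun t ht => by
    obtain rfl : t = t₀ := by simpa using ht
    simp⟩

theorem congr (h : IsIntegralSolution F t₀ x₀ (Icc t₀ T) b) (hbc : EqOn c b (Icc t₀ T)) :
    IsIntegralSolution F t₀ x₀ (Icc t₀ T) c := by
  refine ⟨h.continuousOn.congr hbc, fun t ht => ?_⟩
  have hint : ∫ s in t₀..t, F s (b s) = ∫ s in t₀..t, F s (c s) :=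
    intervalIntegral.integral_congr fun s hs => by
      rw [uIcc_of_le ht.1] at hs
      simp only [hbc ⟨hs.1, hs.2.trans ht.2⟩]
  rw [hbc ht, h.eqOn_picard ht, ODE.picard_apply, ODE.picard_apply, hint]

theorem of_forall_exists_Icc (h : ∀ t ∈ J, t₀ ≤ t)
    (hloc : ∀ t ∈ J, ∃ T > t, IsIntegralSolution F t₀ x₀ (Icc t₀ T) b) :
    IsIntegralSolution F t₀ x₀ J b := by
  refine ⟨fun t ht => ?_, fun t ht => ?_⟩ <;> obtain ⟨T, htT, hb⟩ := hloc t ht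
  · refine (hb.continuousOn t ⟨h t ht, htT.le⟩).mono_of_mem_nhdsWithin ?_
    filter_upwards [self_mem_nhdsWithin, mem_nhdsWithin_of_mem_nhds (Iio_mem_nhds htT)]
      with s hs hsT
    exact ⟨h s hs, le_of_lt hsT⟩
  · exact hb.eqOn_picard ⟨h t ht, htT.le⟩

theorem continuousOn_field (hF : Continuous (Function.uncurry F))
    (h : IsIntegralSolution F t₀ x₀ J b) : ContinuousOn (fun s => F s (b s)) J :=
  hF.comp_continuousOn (continuousOn_id.prodMk h.continuousOn)

theorem exists_norm_le (h : IsIntegralSolution F t₀ x₀ (Icc t₀ T) b) :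
    ∃ R : ℝ, ∀ t ∈ Icc t₀ T, ‖b t‖ ≤ R :=
  isCompact_Icc.exists_bound_of_continuousOn h.continuousOn

theorem hasDerivWithinAt [CompleteSpace X] (hF : Continuous (Function.uncurry F))
    (h : IsIntegralSolution F t₀ x₀ (Icc t₀ T) b) {t : ℝ} (ht : t ∈ Ico t₀ T) :
    HasDerivWithinAt b (F t (b t)) (Ici t) t := by
  have htT := Ico_subset_Icc_self ht
  have hpicard := ODE.hasDerivWithinAt_picard_Icc (left_mem_Icc.mpr (ht.1.trans ht.2.le))
    hF.continuousOn h.continuousOn (mapsTo_univ b _) x₀ htT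
  refine (hpicard.congr h.eqOn_picard (h.eqOn_picard htT)).mono_of_mem_nhdsWithin ?_
  filter_upwards [Icc_mem_nhdsGE ht.2] with r hr
  exact ⟨ht.1.trans hr.1, hr.2⟩

theorem eqOn [CompleteSpace X] (hF : IsUniformLipschitzField F)
    (hb : IsIntegralSolution F t₀ x₀ (Icc t₀ T) b)
    (hc : IsIntegralSolution F t₀ x₀ (Icc t₀ T) c) : EqOn b c (Icc t₀ T) := by
  intro t ht
  have hT : t₀ ∈ Icc t₀ T := left_mem_Icc.mpr (ht.1.trans ht.2)
  obtain ⟨R₁, h₁⟩ := hb.exists_norm_le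
  obtain ⟨R₂, h₂⟩ := hc.exists_norm_le
  obtain ⟨K, hK⟩ := hF.lipschitzOnWith (max R₁ R₂)
  refine ODE_solution_unique_of_mem_Icc_right (s := fun _ => closedBall 0 (max R₁ R₂))
    (fun t _ => hK t) hb.continuousOn (fun t ht => hb.hasDerivWithinAt hF.continuous ht)
    (fun t ht => ?_) hc.continuousOn (fun t ht => hc.hasDerivWithinAt hF.continuous ht)
    (fun t ht => ?_) ((hb.apply_left hT).trans (hc.apply_left hT).symm) ht
  · simpa using Or.inl (h₁ t (Ico_subset_Icc_self ht))
  · simpa using Or.inr (h₂ t (Ico_subset_Icc_self ht))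

open Classical in
theorem append (hF : Continuous (Function.uncurry F)) (h₀ : t₀ ≤ t₁) (h₁ : t₁ ≤ T)
    (hb : IsIntegralSolution F t₀ x₀ (Icc t₀ t₁) b)
    (hc : IsIntegralSolution F t₁ (b t₁) (Icc t₁ T) c) :
    IsIntegralSolution F t₀ x₀ (Icc t₀ T) ((Iic t₁).piecewise b c) := by
  set u := (Iic t₁).piecewise b c
  have hub : EqOn u b (Icc t₀ t₁) := fun t ht => piecewise_eq_of_mem _ _ _ ht.2
  have huc : EqOn u c (Icc t₁ T) := fun t ht => by
    rcases ht.1.eq_or_lt with rfl | h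
    · exact (hub (right_mem_Icc.mpr h₀)).trans (hc.apply_left (left_mem_Icc.mpr h₁)).symm
    · exact piecewise_eq_of_notMem _ _ _ (not_le.mpr h)
  have hbu := hb.congr hub
  have hcu := hc.congr huc
  refine ⟨?_, fun t ht => ?_⟩
  · rw [← Icc_union_Icc_eq_Icc h₀ h₁]
    exact hbu.continuousOn.union_of_isClosed hcu.continuousOn isClosed_Icc isClosed_Icc
  rcases le_total t t₁ with h | h
  · exact hbu.eqOn_picard ⟨ht.1, h⟩
  · have hint₀ : IntervalIntegrable (fun s => F s (u s)) volume t₀ t₁ :=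
      (hbu.continuousOn_field hF).intervalIntegrable_of_Icc h₀
    have hint₁ : IntervalIntegrable (fun s => F s (u s)) volume t₁ t :=
      ((hcu.mono_right ht.2).continuousOn_field hF).intervalIntegrable_of_Icc h
    rw [hcu.eqOn_picard ⟨h, ht.2⟩, ODE.picard_apply, ← hub (right_mem_Icc.mpr h₀),
      hbu.eqOn_picard (right_mem_Icc.mpr h₀), ODE.picard_apply, add_assoc,
      intervalIntegral.integral_add_adjacent_intervals hint₀ hint₁, ODE.picard_apply]

end IsIntegralSolution

theorem IsUniformLipschitzField.exists_pos_forall_exists_isIntegralSolution [CompleteSpace X]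
    {F : ℝ → X → X} (hF : IsUniformLipschitzField F) (R : ℝ) :
    ∃ τ > 0, ∀ (t₁ : ℝ) (x₁ : X), ‖x₁‖ ≤ R →
      ∃ c, IsIntegralSolution F t₁ x₁ (Icc t₁ (t₁ + τ)) c := by
  obtain ⟨K, hK⟩ := hF.lipschitzOnWith (R + 1)
  obtain ⟨C, hC⟩ := hF.norm_le (R + 1)
  have hC₀ : (0 : ℝ) < C + 1 := by positivity
  have hτ : (0 : ℝ) < 1 / (C + 1) := by positivity
  refine ⟨1 / (C + 1), hτ, fun t₁ x₁ hx => ?_⟩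
  have hsub : closedBall x₁ ((1 : ℝ≥0) : ℝ) ⊆ closedBall (0 : X) (R + 1) :=
    closedBall_subset_closedBall' (by rw [dist_zero_right, NNReal.coe_one]; linarith)
  have ht₁ : t₁ ∈ Icc t₁ (t₁ + 1 / (C + 1)) := left_mem_Icc.mpr (by linarith)
  have hpicard : IsPicardLindelof F (⟨t₁, ht₁⟩ : Icc t₁ (t₁ + 1 / (C + 1))) x₁ 1 0 C K := by
    refine ⟨fun t _ => (hK t).mono hsub, fun x _ => ?_, fun t _ x hx => hC t x (hsub hx), ?_⟩
    · exact (hF.continuous.comp (Continuous.prodMk_left x)).continuousOn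
    · have : (C : ℝ) * (1 / (C + 1)) ≤ 1 := by
        rw [mul_one_div, div_le_one hC₀]; linarith
      simpa [hC₀.le] using this
  obtain ⟨c, hc₀, hc⟩ := hpicard.exists_eq_forall_mem_Icc_hasDerivWithinAt₀
  refine ⟨c, fun t ht => (hc t ht).continuousWithinAt, fun t ht => ?_⟩
  have hsub : uIcc t₁ t ⊆ Icc t₁ (t₁ + 1 / (C + 1)) := uIcc_subset_Icc ht₁ ht
  rw [← show c t₁ = x₁ from hc₀]
  exact (ODE.picard_eq_of_hasDerivAt hF.continuous.continuousOn
    (fun s hs => (hc s (hsub hs)).mono hsub) (mapsTo_univ c _)).symm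

section Maximal

/-- The supremum of the times up to which `b' = F t b`, `b t₀ = x₀` is solvable. -/
noncomputable def lifespan (F : ℝ → X → X) (t₀ : ℝ) (x₀ : X) : EReal :=
  sSup ((↑) '' {T : ℝ | ∃ b, IsIntegralSolution F t₀ x₀ (Icc t₀ T) b})

/-- `b` is a maximal solution, on `[t₀, Tmax)`: its norm blows up at a finite `Tmax`. -/
structure IsMaximalIntegralSolution (F : ℝ → X → X) (t₀ : ℝ) (x₀ : X) (Tmax : EReal)
    (b : ℝ → X) : Prop where
  lt : (t₀ : EReal) < Tmax
  isSolution : IsIntegralSolution F t₀ x₀ {t : ℝ | t₀ ≤ t ∧ (t : EReal) < Tmax} b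
  blowup : ∀ T : ℝ, Tmax = (T : EReal) → Tendsto (fun t => ‖b t‖) (𝓝[<] T) atTop

theorem Icc_subset_setOf_coe_lt {t₀ T : ℝ} {Tmax : EReal} (hT : (T : EReal) < Tmax) :
    Icc t₀ T ⊆ {t : ℝ | t₀ ≤ t ∧ (t : EReal) < Tmax} :=
  fun _ ht => ⟨ht.1, (EReal.coe_le_coe_iff.mpr ht.2).trans_lt hT⟩

theorem IsMaximalIntegralSolution.isSolution_Icc {F : ℝ → X → X} {t₀ T : ℝ} {x₀ : X}
    {Tmax : EReal} {b : ℝ → X} (hb : IsMaximalIntegralSolution F t₀ x₀ Tmax b)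
    (hT : (T : EReal) < Tmax) : IsIntegralSolution F t₀ x₀ (Icc t₀ T) b :=
  hb.isSolution.mono (Icc_subset_setOf_coe_lt hT)

theorem IsMaximalIntegralSolution.coe_lt {F : ℝ → X → X} {t₀ T R : ℝ} {x₀ : X}
    {Tmax : EReal} {b : ℝ → X} (hb : IsMaximalIntegralSolution F t₀ x₀ Tmax b)
    (hR : ∀ t ∈ Icc t₀ T, (t : EReal) < Tmax → ‖b t‖ ≤ R) : (T : EReal) < Tmax := by
  by_contra! hle
  obtain ⟨T', rfl⟩ : ∃ T' : ℝ, (T' : EReal) = Tmax :=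
    ⟨Tmax.toReal, EReal.coe_toReal (hle.trans_lt (EReal.coe_lt_top T)).ne
      ((EReal.bot_lt_coe t₀).trans hb.lt).ne'⟩
  obtain ⟨t, htR, ht⟩ := (((hb.blowup T' rfl).eventually_gt_atTop R).and
    (Ioo_mem_nhdsLT (EReal.coe_lt_coe_iff.mp hb.lt))).exists
  exact htR.not_ge (hR t ⟨ht.1.le, ht.2.le.trans (EReal.coe_le_coe_iff.mp hle)⟩
    (EReal.coe_lt_coe_iff.mpr ht.2))

theorem exists_isIntegralSolution_of_coe_lt_lifespan {F : ℝ → X → X} {t₀ t : ℝ} {x₀ : X}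
    (ht : (t : EReal) < lifespan F t₀ x₀) :
    ∃ T > t, ∃ b, IsIntegralSolution F t₀ x₀ (Icc t₀ T) b := by
  obtain ⟨_, ⟨T, hT, rfl⟩, htT⟩ := lt_sSup_iff.mp ht
  exact ⟨T, EReal.coe_lt_coe_iff.mp htT, hT⟩

variable [CompleteSpace X] {F : ℝ → X → X} {t₀ : ℝ} {x₀ : X}

namespace IsUniformLipschitzField

theorem exists_pos_add_le_lifespan (hF : IsUniformLipschitzField F) (R : ℝ) :
    ∃ τ > 0, ∀ t₁ ≥ t₀, ∀ b, IsIntegralSolution F t₀ x₀ (Icc t₀ t₁) b → ‖b t₁‖ ≤ R →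
      ((t₁ + τ : ℝ) : EReal) ≤ lifespan F t₀ x₀ := by
  obtain ⟨τ, hτ, hsol⟩ := hF.exists_pos_forall_exists_isIntegralSolution R
  refine ⟨τ, hτ, fun t₁ ht₁ b hb hR => ?_⟩
  obtain ⟨c, hc⟩ := hsol t₁ (b t₁) hR
  exact le_sSup (mem_image_of_mem _
    ⟨_, hb.append hF.continuous ht₁ (le_add_of_nonneg_right hτ.le) hc⟩)

theorem coe_lt_lifespan (hF : IsUniformLipschitzField F) {T : ℝ} (hT : t₀ ≤ T) {b : ℝ → X}
    (hb : IsIntegralSolution F t₀ x₀ (Icc t₀ T) b) : (T : EReal) < lifespan F t₀ x₀ := by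
  obtain ⟨τ, hτ, hext⟩ := hF.exists_pos_add_le_lifespan (t₀ := t₀) (x₀ := x₀) ‖b T‖
  exact (EReal.coe_lt_coe_iff.mpr (lt_add_of_pos_right T hτ)).trans_le (hext T hT b hb le_rfl)

theorem exists_forall_eqOn (hF : IsUniformLipschitzField F) (t₀ : ℝ) (x₀ : X) :
    ∃ u : ℝ → X, ∀ (T : ℝ) (b : ℝ → X), IsIntegralSolution F t₀ x₀ (Icc t₀ T) b →
      EqOn b u (Icc t₀ T) := by
  have hex : ∀ t, ∃ y, ∀ b, t₀ ≤ t → IsIntegralSolution F t₀ x₀ (Icc t₀ t) b → b t = y := by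
    intro t
    by_cases h : ∃ b, IsIntegralSolution F t₀ x₀ (Icc t₀ t) b
    · obtain ⟨c, hc⟩ := h
      exact ⟨c t, fun b ht hb => hb.eqOn hF hc (right_mem_Icc.mpr ht)⟩
    · exact ⟨0, fun b _ hb => (h ⟨b, hb⟩).elim⟩
  choose u hu using hex
  exact ⟨u, fun T b hb t ht => hu t b ht.1 (hb.mono_right ht.2)⟩

theorem tendsto_norm_atTop_of_lifespan_eq (hF : IsUniformLipschitzField F) {b : ℝ → X} {T : ℝ}
    (hT : t₀ < T) (hlife : lifespan F t₀ x₀ = T)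
    (hb : IsIntegralSolution F t₀ x₀ {t : ℝ | t₀ ≤ t ∧ (t : EReal) < lifespan F t₀ x₀} b) :
    Tendsto (fun t => ‖b t‖) (𝓝[<] T) atTop := by
  refine tendsto_atTop.mpr fun R => ?_
  obtain ⟨τ, hτ, hext⟩ := hF.exists_pos_add_le_lifespan (t₀ := t₀) (x₀ := x₀) R
  filter_upwards [Ioo_mem_nhdsLT (max_lt hT (sub_lt_self T hτ))] with t ht
  obtain ⟨ht₀, htτ⟩ := max_lt_iff.mp ht.1
  by_contra! hR
  have hsol := hb.mono (Icc_subset_setOf_coe_lt (hlife ▸ EReal.coe_lt_coe_iff.mpr ht.2))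
  have := EReal.coe_le_coe_iff.mp (hlife ▸ hext t ht₀.le b hsol hR.le)
  linarith

theorem exists_isMaximalIntegralSolution (hF : IsUniformLipschitzField F) (t₀ : ℝ) (x₀ : X) :
    ∃ (Tmax : EReal) (u : ℝ → X), IsMaximalIntegralSolution F t₀ x₀ Tmax u ∧
      ∀ (T : ℝ) (v : ℝ → X), t₀ ≤ T → IsIntegralSolution F t₀ x₀ (Icc t₀ T) v →
        (T : EReal) < Tmax ∧ EqOn v u (Icc t₀ T) := by
  obtain ⟨u, hu⟩ := hF.exists_forall_eqOn t₀ x₀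
  have hlt : (t₀ : EReal) < lifespan F t₀ x₀ := hF.coe_lt_lifespan le_rfl (.const F t₀ x₀)
  have hsol : IsIntegralSolution F t₀ x₀ {t : ℝ | t₀ ≤ t ∧ (t : EReal) < lifespan F t₀ x₀} u := by
    refine .of_forall_exists_Icc (fun t ht => ht.1) fun t ht => ?_
    obtain ⟨T, htT, b, hb⟩ := exists_isIntegralSolution_of_coe_lt_lifespan ht.2
    exact ⟨T, htT, hb.congr (hu T b hb).symm⟩
  have hblowup (T : ℝ) (hT : lifespan F t₀ x₀ = T) : Tendsto (fun t => ‖u t‖) (𝓝[<] T) atTop :=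
    hF.tendsto_norm_atTop_of_lifespan_eq (EReal.coe_lt_coe_iff.mp (hT ▸ hlt)) hT hsol
  exact ⟨lifespan F t₀ x₀, u, ⟨hlt, hsol, hblowup⟩,
    fun T v hT hv => ⟨hF.coe_lt_lifespan hT hv, hu T v hv⟩⟩

end IsUniformLipschitzField

end Maximal

section ContinuousDependence

theorem forall_lt_of_forall_Ico_lt {f : ℝ → ℝ} {a b η : ℝ} (hf : ContinuousOn f (Icc a b))
    (hstep : ∀ r ∈ Icc a b, (∀ t ∈ Ico a r, f t < η) → f r < η) : ∀ t ∈ Icc a b, f t < η := by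
  by_contra! hne
  have hcompact : IsCompact (Icc a b ∩ f ⁻¹' Ici η) :=
    isCompact_Icc.of_isClosed_subset (hf.preimage_isClosed_of_isClosed isClosed_Icc isClosed_Ici)
      inter_subset_left
  obtain ⟨r, hr, hleast⟩ := hcompact.exists_isLeast hne
  refine (hstep r hr.1 fun t ht => ?_).not_ge hr.2
  by_contra! hη
  exact (hleast ⟨⟨ht.1, ht.2.le.trans hr.1.2⟩, hη⟩).not_gt ht.2

variable [CompleteSpace X] {F G : ℝ → X → X} {t₀ T : ℝ} {x₀ : X} {b c : ℝ → X} {R δ η : ℝ}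
  {K : ℝ≥0}

theorem IsIntegralSolution.norm_sub_le_gronwallBound (hT : t₀ ≤ T)
    (hF : Continuous (Function.uncurry F)) (hG : Continuous (Function.uncurry G))
    (hb : IsIntegralSolution F t₀ x₀ (Icc t₀ T) b) (hc : IsIntegralSolution G t₀ x₀ (Icc t₀ T) c)
    (hK : ∀ t, LipschitzOnWith K (F t) (closedBall 0 R))
    (hbR : ∀ t ∈ Ico t₀ T, ‖b t‖ ≤ R) (hcR : ∀ t ∈ Ico t₀ T, ‖c t‖ ≤ R)
    (hδ : ∀ t ∈ Ico t₀ T, ‖F t (c t) - G t (c t)‖ ≤ δ) :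
    ‖b T - c T‖ ≤ gronwallBound 0 K δ (T - t₀) := by
  have ht₀ : t₀ ∈ Icc t₀ T := left_mem_Icc.mpr hT
  have h := dist_le_of_approx_trajectories_ODE_of_mem (v := F) (δ := 0) (εf := 0) (εg := δ)
    (s := fun _ => closedBall 0 R) (fun t _ => hK t) hb.continuousOn
    (fun t ht => hb.hasDerivWithinAt hF ht) (fun t _ => (dist_self _).le)
    (fun t ht => mem_closedBall_zero_iff.mpr (hbR t ht)) hc.continuousOn
    (fun t ht => hc.hasDerivWithinAt hG ht)
    (fun t ht => by rw [dist_comm, dist_eq_norm]; exact hδ t ht)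
    (fun t ht => mem_closedBall_zero_iff.mpr (hcR t ht))
    (by rw [hb.apply_left ht₀, hc.apply_left ht₀, dist_self]) T (right_mem_Icc.mpr hT)
  rwa [dist_eq_norm, zero_add] at h

/-- As long as `‖b - c‖ < 1`, both solutions stay in the ball of radius `R + 1`, where Grönwall's
inequality applies and keeps them closer than `η`. -/
theorem IsIntegralSolution.norm_sub_lt (hF : Continuous (Function.uncurry F))
    (hG : Continuous (Function.uncurry G)) (hb : IsIntegralSolution F t₀ x₀ (Icc t₀ T) b)
    (hc : IsIntegralSolution G t₀ x₀ (Icc t₀ T) c)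
    (hK : ∀ t, LipschitzOnWith K (F t) (closedBall 0 (R + 1)))
    (hcR : ∀ t ∈ Icc t₀ T, ‖c t‖ ≤ R) (hδ : ∀ t ∈ Icc t₀ T, ‖F t (c t) - G t (c t)‖ ≤ δ)
    (hη : η ≤ 1) (hδη : gronwallBound 0 K δ (T - t₀) < η) :
    ∀ t ∈ Icc t₀ T, ‖b t - c t‖ < η := by
  refine forall_lt_of_forall_Ico_lt (hb.continuousOn.sub hc.continuousOn).norm fun r hr hlt => ?_
  have hIT (t : ℝ) (ht : t ∈ Ico t₀ r) : t ∈ Icc t₀ T := ⟨ht.1, ht.2.le.trans hr.2⟩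
  have hδ₀ : 0 ≤ δ := (norm_nonneg _).trans (hδ r hr)
  calc ‖b r - c r‖ ≤ gronwallBound 0 K δ (r - t₀) := by
        refine (hb.mono_right hr.2).norm_sub_le_gronwallBound hr.1 hF hG (hc.mono_right hr.2) hK
          (fun t ht => ?_) (fun t ht => ?_) fun t ht => hδ t (hIT t ht)
        · linarith [norm_sub_norm_le (b t) (c t), hlt t ht, hcR t (hIT t ht)]
        · linarith [hcR t (hIT t ht)]
    _ ≤ gronwallBound 0 K δ (T - t₀) :=
        gronwallBound_mono le_rfl hδ₀ K.2 (sub_le_sub_right hr.2 t₀)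
    _ < η := hδη

theorem IsMaximalIntegralSolution.coe_lt_and_norm_sub_lt {Tmax : EReal}
    (hF : Continuous (Function.uncurry F)) (hG : Continuous (Function.uncurry G))
    (hb : IsMaximalIntegralSolution F t₀ x₀ Tmax b)
    (hc : IsIntegralSolution G t₀ x₀ (Icc t₀ T) c)
    (hK : ∀ t, LipschitzOnWith K (F t) (closedBall 0 (R + 1)))
    (hcR : ∀ t ∈ Icc t₀ T, ‖c t‖ ≤ R) (hδ : ∀ t ∈ Icc t₀ T, ‖F t (c t) - G t (c t)‖ ≤ δ)
    (hη : η ≤ 1) (hδη : gronwallBound 0 K δ (T - t₀) < η) :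
    (T : EReal) < Tmax ∧ ∀ t ∈ Icc t₀ T, ‖b t - c t‖ < η := by
  have hclose : ∀ T' ≤ T, (T' : EReal) < Tmax → ∀ t ∈ Icc t₀ T', ‖b t - c t‖ < η := by
    intro T' hT' hTmax t ht
    have hsub : Icc t₀ T' ⊆ Icc t₀ T := Icc_subset_Icc_right hT'
    have hδ₀ : 0 ≤ δ := (norm_nonneg _).trans (hδ t (hsub ht))
    exact (hb.isSolution_Icc hTmax).norm_sub_lt hF hG (hc.mono_right hT') hK
      (fun t ht => hcR t (hsub ht)) (fun t ht => hδ t (hsub ht)) hη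
      ((gronwallBound_mono le_rfl hδ₀ K.2 (sub_le_sub_right hT' t₀)).trans_lt hδη) t ht
  have hTmax : (T : EReal) < Tmax := hb.coe_lt (R := R + 1) fun t ht htmax => by
    linarith [norm_sub_norm_le (b t) (c t), hclose t ht.2 htmax t (right_mem_Icc.mpr ht.1),
      hcR t ht]
  exact ⟨hTmax, hclose T le_rfl hTmax⟩

theorem exists_pos_gronwallBound_lt (K x : ℝ) {η : ℝ} (hη : 0 < η) :
    ∃ δ > 0, gronwallBound 0 K δ x < η := by
  have hlim : Tendsto (fun δ => gronwallBound 0 K δ x) (𝓝[>] 0) (𝓝 0) := by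
    simpa [gronwallBound_ε0] using
      ((gronwallBound_continuous_ε 0 K x).tendsto 0).mono_left nhdsWithin_le_nhds
  obtain ⟨δ, hδη, hδ⟩ := ((hlim.eventually (Iio_mem_nhds hη)).and self_mem_nhdsWithin).exists
  exact ⟨δ, hδ, hδη⟩

theorem eventually_coe_lt_and_tendstoUniformlyOn {ι : Type*} {l : Filter ι} {F : ι → ℝ → X → X}
    (hF : ∀ i, Continuous (Function.uncurry (F i)))
    (hlip : ∀ R : ℝ, ∃ K : ℝ≥0, ∀ i t, LipschitzOnWith K (F i t) (closedBall 0 R))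
    (hG : Continuous (Function.uncurry G)) {Tmax : ι → EReal} {b : ι → ℝ → X}
    (hb : ∀ᶠ i in l, IsMaximalIntegralSolution (F i) t₀ x₀ (Tmax i) (b i))
    (hc : IsIntegralSolution G t₀ x₀ (Icc t₀ T) c)
    (hFG : TendstoUniformlyOn (fun i t => F i t (c t)) (fun t => G t (c t)) l (Icc t₀ T)) :
    (∀ᶠ i in l, (T : EReal) < Tmax i) ∧ TendstoUniformlyOn b c l (Icc t₀ T) := by
  obtain ⟨R, hR⟩ := hc.exists_norm_le
  obtain ⟨K, hK⟩ := hlip (R + 1)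
  have hclose {η : ℝ} (hη : 0 < η) (hη₁ : η ≤ 1) :
      ∀ᶠ i in l, (T : EReal) < Tmax i ∧ ∀ t ∈ Icc t₀ T, ‖b i t - c t‖ < η := by
    obtain ⟨δ, hδ, hδη⟩ := exists_pos_gronwallBound_lt K (T - t₀) hη
    filter_upwards [hb, Metric.tendstoUniformlyOn_iff.mp hFG δ hδ] with i hbi hδi
    refine hbi.coe_lt_and_norm_sub_lt (hF i) hG hc (hK i) hR (fun t ht => ?_) hη₁ hδη
    rw [← dist_eq_norm, dist_comm]
    exact (hδi t ht).le
  refine ⟨(hclose one_pos le_rfl).mono fun i h => h.1, Metric.tendstoUniformlyOn_iff.mpr ?_⟩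
  intro η hη
  filter_upwards [hclose (lt_min hη one_pos) (min_le_right η 1)] with i hi t ht
  rw [dist_comm, dist_eq_norm]
  exact (hi.2 t ht).trans_le (min_le_left η 1)

end ContinuousDependence

end IntegralEquations

section LipschitzOnBalls

open Metric
open scoped NNReal

/-- `f` is Lipschitz on every ball. -/
def IsLipschitzOnBalls {X Y : Type*} [NormedAddCommGroup X] [NormedAddCommGroup Y] (f : X → Y) :
    Prop :=
  ∀ R : ℝ, ∃ K : ℝ≥0, LipschitzOnWith K f (closedBall 0 R)

namespace IsLipschitzOnBalls

variable {X Y Z W : Type*} [NormedAddCommGroup X] [NormedAddCommGroup Y] [NormedAddCommGroup Z]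
  [NormedAddCommGroup W]

theorem of_lipschitzWith {K : ℝ≥0} {f : X → Y} (hf : LipschitzWith K f) : IsLipschitzOnBalls f :=
  fun _ => ⟨K, hf.lipschitzOnWith⟩

theorem exists_norm_le {f : X → Y} (hf : IsLipschitzOnBalls f) (R : ℝ) :
    ∃ C : ℝ≥0, ∀ x ∈ closedBall (0 : X) R, ‖f x‖ ≤ C := by
  obtain ⟨K, hK⟩ := hf R
  refine ⟨K * R.toNNReal + ‖f 0‖₊, fun x hx => ?_⟩
  have hxR : ‖x‖ ≤ R := mem_closedBall_zero_iff.mp hx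
  have hR : 0 ≤ R := (norm_nonneg x).trans hxR
  calc ‖f x‖ ≤ ‖f x - f 0‖ + ‖f 0‖ := norm_le_norm_sub_add _ _
    _ ≤ K * ‖x‖ + ‖f 0‖ := by
        gcongr
        simpa [dist_eq_norm] using hK.dist_le_mul x hx 0 (mem_closedBall_self hR)
    _ ≤ ↑(K * R.toNNReal + ‖f 0‖₊) := by
        rw [NNReal.coe_add, NNReal.coe_mul, Real.coe_toNNReal R hR, coe_nnnorm]
        gcongr

theorem continuous {f : X → Y} (hf : IsLipschitzOnBalls f) : Continuous f := by
  refine continuous_iff_continuousAt.mpr fun x => ?_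
  obtain ⟨K, hK⟩ := hf (‖x‖ + 1)
  refine hK.continuousOn.continuousAt (mem_of_superset (closedBall_mem_nhds x one_pos) ?_)
  exact closedBall_subset_closedBall' (by rw [dist_zero_right, add_comm])

theorem lipschitz_comp {K : ℝ≥0} {g : Y → Z} (hg : LipschitzWith K g) {f : X → Y}
    (hf : IsLipschitzOnBalls f) : IsLipschitzOnBalls fun x => g (f x) := fun R => by
  obtain ⟨C, hC⟩ := hf R
  exact ⟨K * C, hg.comp_lipschitzOnWith hC⟩

theorem bilinear {𝕜 : Type*} [NontriviallyNormedField 𝕜] [NormedSpace 𝕜 Y] [NormedSpace 𝕜 Z]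
    [NormedSpace 𝕜 W] (M : Y →L[𝕜] Z →L[𝕜] W) {f : X → Y} {g : X → Z}
    (hf : IsLipschitzOnBalls f) (hg : IsLipschitzOnBalls g) :
    IsLipschitzOnBalls fun x => M (f x) (g x) := fun R => by
  obtain ⟨Kf, hKf⟩ := hf R
  obtain ⟨Kg, hKg⟩ := hg R
  obtain ⟨Cf, hCf⟩ := hf.exists_norm_le R
  obtain ⟨Cg, hCg⟩ := hg.exists_norm_le R
  refine ⟨‖M‖₊ * (Kf * Cg + Cf * Kg), LipschitzOnWith.of_dist_le_mul fun a ha b hb => ?_⟩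
  have hsplit : M (f a) (g a) - M (f b) (g b) = M (f a - f b) (g a) + M (f b) (g a - g b) := by
    simp only [map_sub, sub_apply]
    abel
  have hfab : ‖f a - f b‖ ≤ Kf * dist a b := dist_eq_norm (f a) (f b) ▸ hKf.dist_le_mul a ha b hb
  have hgab : ‖g a - g b‖ ≤ Kg * dist a b := dist_eq_norm (g a) (g b) ▸ hKg.dist_le_mul a ha b hb
  rw [dist_eq_norm, hsplit]
  calc ‖M (f a - f b) (g a) + M (f b) (g a - g b)‖
      ≤ ‖M‖ * ‖f a - f b‖ * ‖g a‖ + ‖M‖ * ‖f b‖ * ‖g a - g b‖ :=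
        (norm_add_le _ _).trans (add_le_add (M.le_opNorm₂ _ _) (M.le_opNorm₂ _ _))
    _ ≤ ‖M‖ * (Kf * dist a b) * Cg + ‖M‖ * Cf * (Kg * dist a b) := by
        gcongr
        · exact hCg a ha
        · exact hCf b hb
    _ = ↑(‖M‖₊ * (Kf * Cg + Cf * Kg)) * dist a b := by push_cast; ring

end IsLipschitzOnBalls

end LipschitzOnBalls

section InteractionPicture

open Metric
open scoped NNReal

theorem tendstoUniformlyOn_comp_of_isCompact {ι α β γ : Type*} [TopologicalSpace α]
    [UniformSpace β] [UniformSpace γ] {l : Filter ι} {K : Set α} (hK : IsCompact K)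
    {p : ι → α → β} {p₀ : α → β} (hp₀ : ContinuousOn p₀ K) (hp : TendstoUniformlyOn p p₀ l K)
    {Ψ : β → γ} (hΨ : Continuous Ψ) :
    TendstoUniformlyOn (fun i t => Ψ (p i t)) (fun t => Ψ (p₀ t)) l K := fun V hV => by
  have hunif := (hK.image_of_continuousOn hp₀).uniformContinuousAt_of_continuousAt Ψ
    (fun _ _ => hΨ.continuousAt) hV
  filter_upwards [hp _ hunif] with i hi t ht
  exact hi t ht (mem_image_of_mem p₀ ht)

variable {X : Type*} [NormedAddCommGroup X] [NormedSpace ℝ X]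

/-- A strongly continuous one-parameter group of linear isometries. -/
structure IsIsometryGroup (S : ℝ → X →ₗᵢ[ℝ] X) : Prop where
  map_zero : ∀ x, S 0 x = x
  map_add : ∀ r r' x, S (r + r') x = S r (S r' x)
  continuous_apply : ∀ x, Continuous fun r => S r x

namespace IsIsometryGroup

variable {S : ℝ → X →ₗᵢ[ℝ] X}

theorem apply_neg_apply (hS : IsIsometryGroup S) (r : ℝ) (x : X) : S r (S (-r) x) = x := by
  rw [← hS.map_add, add_neg_cancel, hS.map_zero]

theorem continuous_uncurry (hS : IsIsometryGroup S) : Continuous fun p : ℝ × X => S p.1 p.2 :=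
  continuous_prod_of_continuous_lipschitzWith' _ 1 (fun r => (S r).isometry.lipschitz)
    hS.continuous_apply

end IsIsometryGroup

/-- The nonlinearity `N` seen in the interaction picture: it is conjugated by the free flow `S` up
to the accumulated dispersion `r`. -/
noncomputable def interactionField (S : ℝ → X →ₗᵢ[ℝ] X) (N : X → X) (r : ℝ) (x : X) : X :=
  S (-r) (N (S r x))

/-- `w` solves on `J` Duhamel's formula for `w' = g(t) A w + N w`, `w t₀ = a`, where `A` generates
the group `S`. -/
structure IsMildSolution (S : ℝ → X →ₗᵢ[ℝ] X) (N : X → X) (g : ℝ → ℝ) (t₀ : ℝ) (a : X)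
    (J : Set ℝ) (w : ℝ → X) : Prop where
  continuousOn : ContinuousOn w J
  duhamel : ∀ t ∈ J, w t = S (∫ τ in t₀..t, g τ) a +
    ∫ s in t₀..t, S (∫ τ in s..t, g τ) (N (w s))

variable {S : ℝ → X →ₗᵢ[ℝ] X} {N : X → X}

theorem continuous_interactionField (hS : IsIsometryGroup S) (hN : Continuous N) :
    Continuous fun p : ℝ × X => interactionField S N p.1 p.2 :=
  hS.continuous_uncurry.comp (continuous_fst.neg.prodMk (hN.comp hS.continuous_uncurry))

theorem lipschitzOnWith_interactionField {K : ℝ≥0} {R : ℝ}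
    (hN : LipschitzOnWith K N (closedBall 0 R)) (r : ℝ) :
    LipschitzOnWith K (interactionField S N r) (closedBall 0 R) := by
  have hmaps : MapsTo (S r) (closedBall 0 R) (closedBall 0 R) := fun x hx => by
    simpa using hx
  have hcomp := (S (-r)).isometry.lipschitz.comp_lipschitzOnWith
    (hN.comp (S r).isometry.lipschitz.lipschitzOnWith hmaps)
  rwa [one_mul, mul_one] at hcomp

theorem isUniformLipschitzField_interactionField (hS : IsIsometryGroup S)
    (hN : IsLipschitzOnBalls N) {θ : ℝ → ℝ} (hθ : Continuous θ) :
    IsUniformLipschitzField fun t => interactionField S N (θ t) where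
  continuous := (continuous_interactionField hS hN.continuous).comp
    ((hθ.comp continuous_fst).prodMk continuous_snd)
  lipschitzOnWith R :=
    (hN R).imp fun _ hK t => lipschitzOnWith_interactionField hK (θ t)
  norm_le R := (hN.exists_norm_le R).imp fun _ hC t x hx => by
    rw [interactionField, LinearIsometry.norm_map]
    exact hC _ (by simpa using hx)

variable [CompleteSpace X] {g : ℝ → ℝ} {t₀ : ℝ} {a : X}

theorem integral_duhamel_eq (hS : IsIsometryGroup S) (hN : Continuous N)
    (hg : ∀ a b, IntervalIntegrable g volume a b) {t : ℝ} (ht : t₀ ≤ t) {b : ℝ → X}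
    (hb : ContinuousOn b (Icc t₀ t)) :
    ∫ s in t₀..t, S (∫ τ in s..t, g τ) (N (S (∫ τ in t₀..s, g τ) (b s))) =
      S (∫ τ in t₀..t, g τ)
        (∫ s in t₀..t, interactionField S N (∫ τ in t₀..s, g τ) (b s)) := by
  have hθ : Continuous fun s => ∫ τ in t₀..s, g τ := intervalIntegral.continuous_primitive hg t₀
  have hint : IntervalIntegrable (fun s => interactionField S N (∫ τ in t₀..s, g τ) (b s))
      volume t₀ t :=
    ((continuous_interactionField hS hN).comp_continuousOn
      (hθ.continuousOn.prodMk hb)).intervalIntegrable_of_Icc ht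
  refine Eq.trans ?_
    ((S (∫ τ in t₀..t, g τ)).toContinuousLinearMap.intervalIntegral_comp_comm hint)
  refine intervalIntegral.integral_congr fun s _ => ?_
  have hsub : ∫ τ in s..t, g τ = (∫ τ in t₀..t, g τ) + -∫ τ in t₀..s, g τ := by
    rw [← sub_eq_add_neg, intervalIntegral.integral_interval_sub_left (hg _ _) (hg _ _)]
  simp only [hsub, hS.map_add, interactionField, LinearIsometry.coe_toContinuousLinearMap]

theorem isMildSolution_iff_isIntegralSolution (hS : IsIsometryGroup S) (hN : Continuous N)
    (hg : ∀ a b, IntervalIntegrable g volume a b) {J : Set ℝ} (hJ : J.OrdConnected)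
    (ht₀ : IsLeast J t₀) {b : ℝ → X} :
    IsMildSolution S N g t₀ a J (fun t => S (∫ τ in t₀..t, g τ) (b t)) ↔
      IsIntegralSolution (fun t => interactionField S N (∫ τ in t₀..t, g τ)) t₀ a J b := by
  have hθ : Continuous fun s => ∫ τ in t₀..s, g τ := intervalIntegral.continuous_primitive hg t₀
  have hcont : ContinuousOn (fun t => S (∫ τ in t₀..t, g τ) (b t)) J ↔ ContinuousOn b J := by
    refine ⟨fun h => ?_, fun h =>
      hS.continuous_uncurry.comp_continuousOn (hθ.continuousOn.prodMk h)⟩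
    refine (hS.continuous_uncurry.comp_continuousOn (hθ.neg.continuousOn.prodMk h)).congr
      fun t _ => ?_
    simpa using (hS.apply_neg_apply (-∫ τ in t₀..t, g τ) (b t)).symm
  have hduhamel (hb : ContinuousOn b J) (t : ℝ) (ht : t ∈ J) :
      S (∫ τ in t₀..t, g τ) (b t) = S (∫ τ in t₀..t, g τ) a +
        ∫ s in t₀..t, S (∫ τ in s..t, g τ) (N (S (∫ τ in t₀..s, g τ) (b s))) ↔
      b t = ODE.picard (fun t => interactionField S N (∫ τ in t₀..t, g τ)) t₀ a b t := by
    rw [integral_duhamel_eq hS hN hg (ht₀.2 ht) (hb.mono (hJ.out ht₀.1 ht)), ← map_add,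
      (S _).injective.eq_iff, ODE.picard_apply]
  exact ⟨fun h => ⟨hcont.mp h.1, fun t ht => (hduhamel (hcont.mp h.1) t ht).mp (h.2 t ht)⟩,
    fun h => ⟨hcont.mpr h.1, fun t ht => (hduhamel h.1 t ht).mpr (h.2 ht)⟩⟩

theorem eventually_coe_lt_and_tendstoUniformlyOn_interaction (hS : IsIsometryGroup S)
    (hN : IsLipschitzOnBalls N) {ι : Type*} {l : Filter ι} {θ : ι → ℝ → ℝ} {θ₀ : ℝ → ℝ}
    (hθ : ∀ i, Continuous (θ i)) (hθ₀ : Continuous θ₀) {T : ℝ}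
    (hlim : TendstoUniformlyOn θ θ₀ l (Icc t₀ T)) {Tmax : ι → EReal} {b : ι → ℝ → X} {c : ℝ → X}
    (hb : ∀ᶠ i in l, IsMaximalIntegralSolution (fun t => interactionField S N (θ i t)) t₀ a
      (Tmax i) (b i))
    (hc : IsIntegralSolution (fun t => interactionField S N (θ₀ t)) t₀ a (Icc t₀ T) c) :
    (∀ᶠ i in l, (T : EReal) < Tmax i) ∧
      TendstoUniformlyOn (fun i t => S (θ i t) (b i t)) (fun t => S (θ₀ t) (c t)) l (Icc t₀ T) := by
  have hprod {u : ι → ℝ → X} (hu : TendstoUniformlyOn u c l (Icc t₀ T)) :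
      TendstoUniformlyOn (fun i t => (θ i t, u i t)) (fun t => (θ₀ t, c t)) l (Icc t₀ T) :=
    fun V hV => (hlim.prodMk hu V hV).diag_of_prod
  have hcomp {u : ι → ℝ → X} (hu : TendstoUniformlyOn u c l (Icc t₀ T)) {Ψ : ℝ × X → X}
      (hΨ : Continuous Ψ) := tendstoUniformlyOn_comp_of_isCompact isCompact_Icc
    (hθ₀.continuousOn.prodMk hc.continuousOn) (hprod hu) hΨ
  have hconst : TendstoUniformlyOn (fun _ : ι => c) c l (Icc t₀ T) :=
    fun V hV => .of_forall fun _ t _ => refl_mem_uniformity hV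
  have hfield (θ : ℝ → ℝ) (hθ : Continuous θ) :=
    (isUniformLipschitzField_interactionField hS hN hθ).continuous
  obtain ⟨hT, hbc⟩ := eventually_coe_lt_and_tendstoUniformlyOn (fun i => hfield _ (hθ i))
    (fun R => (hN R).imp fun _ hK i t => lipschitzOnWith_interactionField hK (θ i t))
    (hfield θ₀ hθ₀) hb hc (hcomp hconst (continuous_interactionField hS hN.continuous))
  exact ⟨hT, hcomp hbc hS.continuous_uncurry⟩

end InteractionPicture

section BoundedMultipliers

variable {β : Type*} [MeasurableSpace β] {μ : Measure β}

theorem eLpNorm_two_sq_eq_lintegral {F : Type*} [NormedAddCommGroup F] (f : β → F) :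
    eLpNorm f 2 μ ^ 2 = ∫⁻ x, ‖f x‖ₑ ^ 2 ∂μ := by
  simpa using eLpNorm_nnreal_pow_eq_lintegral (μ := μ) (f := f) (p := 2) two_ne_zero

/-- Multiplication by the bounded function `m`, as an operator on `L²`. -/
noncomputable def boundedMul {m : β → ℂ} (hm : MemLp m ∞ μ) : Lp ℂ 2 μ →L[ℂ] Lp ℂ 2 μ :=
  (ContinuousLinearMap.mul ℂ ℂ).holderL μ ∞ 2 2 (hm.toLp m)

theorem coeFn_boundedMul {m : β → ℂ} (hm : MemLp m ∞ μ) (f : Lp ℂ 2 μ) :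
    boundedMul hm f =ᵐ[μ] fun x => m x * f x := by
  filter_upwards [(ContinuousLinearMap.mul ℂ ℂ).coeFn_holder (r := 2) (hm.toLp m) f,
    hm.coeFn_toLp] with x hholder hm'
  rw [boundedMul, ContinuousLinearMap.holderL_apply_apply, hholder, hm',
    ContinuousLinearMap.mul_apply']

theorem toLp_smul_eq_boundedMul {m : β → ℂ} (hm : MemLp m ∞ μ) (f : Lp ℂ 2 μ) :
    (hm.toLp m • f : Lp ℂ 2 μ) = boundedMul hm f := by
  refine Lp.ext ?_
  filter_upwards [Lp.coeFn_lpSMul (r := 2) (hm.toLp m) f, hm.coeFn_toLp, coeFn_boundedMul hm f]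
    with x hsmul hm' hmul
  rw [hsmul, hmul, Pi.smul_apply', hm', smul_eq_mul]

theorem norm_boundedMul {m : β → ℂ} (hm : MemLp m ∞ μ) (hm₁ : ∀ x, ‖m x‖ = 1) (f : Lp ℂ 2 μ) :
    ‖boundedMul hm f‖ = ‖f‖ := by
  rw [Lp.norm_def, Lp.norm_def]
  congr 1
  refine eLpNorm_congr_norm_ae ?_
  filter_upwards [coeFn_boundedMul hm f] with x hx
  rw [hx, norm_mul, hm₁, one_mul]

theorem enorm_boundedMul_sub_sq {m m' : β → ℂ} (hm : MemLp m ∞ μ) (hm' : MemLp m' ∞ μ)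
    (f : Lp ℂ 2 μ) :
    ‖boundedMul hm f - boundedMul hm' f‖ₑ ^ 2 = ∫⁻ x, (‖m x - m' x‖ₑ * ‖f x‖ₑ) ^ 2 ∂μ := by
  rw [Lp.enorm_def, eLpNorm_two_sq_eq_lintegral]
  refine lintegral_congr_ae ?_
  filter_upwards [Lp.coeFn_sub (boundedMul hm f) (boundedMul hm' f), coeFn_boundedMul hm f,
    coeFn_boundedMul hm' f] with x hsub hmul hmul'
  rw [hsub, Pi.sub_apply, hmul, hmul', ← sub_mul, enorm_mul]

theorem continuous_boundedMul_apply {Θ : Type*} [TopologicalSpace Θ] [FirstCountableTopology Θ]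
    {m : Θ → β → ℂ} (hm : ∀ θ, MemLp (m θ) ∞ μ) (hm₁ : ∀ θ x, ‖m θ x‖ ≤ 1)
    (hcont : ∀ x, Continuous fun θ => m θ x) (f : Lp ℂ 2 μ) :
    Continuous fun θ => boundedMul (hm θ) f := by
  refine continuous_iff_continuousAt.mpr fun θ => ?_
  rw [ContinuousAt, tendsto_iff_edist_tendsto_0]
  simp_rw [edist_eq_enorm_sub]
  suffices h : Tendsto (fun θ' => ‖boundedMul (hm θ') f - boundedMul (hm θ) f‖ₑ ^ 2) (𝓝 θ)
      (𝓝 0) by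
    have hsqrt := ((ENNReal.continuous_rpow_const (y := 1 / 2)).tendsto 0).comp h
    simp only [Function.comp_def, ← ENNReal.rpow_two, ← ENNReal.rpow_mul] at hsqrt
    simpa using hsqrt
  have hzero : ∫⁻ x, (‖m θ x - m θ x‖ₑ * ‖f x‖ₑ) ^ 2 ∂μ = 0 := by simp
  simp_rw [enorm_boundedMul_sub_sq, ← hzero]
  have hf : ∫⁻ x, (2 * ‖f x‖ₑ) ^ 2 ∂μ ≠ ∞ := by
    simp_rw [mul_pow]
    rw [lintegral_const_mul' _ _ (by simp), ← eLpNorm_two_sq_eq_lintegral]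
    exact ENNReal.mul_ne_top (by simp) (ENNReal.pow_ne_top (Lp.eLpNorm_ne_top f))
  refine tendsto_lintegral_filter_of_dominated_convergence' _
    (.of_forall fun θ' => ?_) (.of_forall fun θ' => .of_forall fun x => ?_) hf
    (.of_forall fun x => ?_)
  · exact (((hm θ').1.sub (hm θ).1).enorm.mul (Lp.aestronglyMeasurable f).enorm).pow_const 2
  · gcongr
    calc ‖m θ' x - m θ x‖ₑ ≤ ‖m θ' x‖ₑ + ‖m θ x‖ₑ := enorm_sub_le
      _ ≤ 1 + 1 := by gcongr <;> simpa [← ofReal_norm] using hm₁ _ x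
      _ = 2 := one_add_one_eq_two
  · have hsub : Continuous fun θ' => ‖m θ' x - m θ x‖ₑ := ((hcont x).sub continuous_const).enorm
    exact ((ENNReal.continuous_pow 2).tendsto _).comp
      (ENNReal.Tendsto.mul_const (hsub.tendsto θ) (Or.inr (by simp)))

end BoundedMultipliers

section FourierTransform

variable {E F : Type*} [NormedAddCommGroup E] [InnerProductSpace ℝ E] [FiniteDimensional ℝ E]
  [MeasurableSpace E] [BorelSpace E] [NormedAddCommGroup F] [NormedSpace ℂ F]

theorem continuous_fourierInv_of_integrable {f : E → F} (hf : Integrable f) :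
    Continuous (𝓕⁻ f) := by
  rw [Real.fourierInv_eq_fourier_comp_neg]
  exact VectorFourier.fourierIntegral_continuous Real.continuous_fourierChar
    (by exact continuous_inner) hf.comp_neg

variable [CompleteSpace F]

theorem ae_eq_of_integral_schwartz_smul_eq {f g : E → F} (hf : LocallyIntegrable f)
    (hg : LocallyIntegrable g) (hfg : ∀ φ : 𝓢(E, ℂ), ∫ x, φ x • f x = ∫ x, φ x • g x) :
    f =ᵐ[volume] g := by
  refine ae_eq_of_integral_contDiff_smul_eq hf hg fun h hh hhc => ?_
  have hc : HasCompactSupport (Complex.ofRealCLM ∘ h) := hhc.comp_left rfl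
  simpa using! hfg (hc.toSchwartzMap (Complex.ofRealCLM.contDiff.comp hh))

theorem smulLeftCLM_toTemperedDistribution_eq_iff {m : E → ℂ} (hm : m.HasTemperateGrowth)
    {f g : Lp F 2 (volume : Measure E)} :
    TemperedDistribution.smulLeftCLM F m (f : 𝓢'(E, F)) = g ↔
      g =ᵐ[volume] fun ξ => m ξ • f ξ := by
  have happly (φ : 𝓢(E, ℂ)) : TemperedDistribution.smulLeftCLM F m (f : 𝓢'(E, F)) φ =
      ∫ ξ, φ ξ • m ξ • f ξ := by
    rw [TemperedDistribution.smulLeftCLM_apply_apply, Lp.toTemperedDistribution_apply]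
    simp only [SchwartzMap.smulLeftCLM_apply_apply hm, smul_eq_mul, smul_smul, mul_comm]
  have hloc (h : Lp F 2 (volume : Measure E)) : LocallyIntegrable h :=
    (Lp.memLp h).locallyIntegrable one_le_two
  refine ⟨fun h => ae_eq_of_integral_schwartz_smul_eq (hloc g)
    ((hloc f).continuous_smul hm.1.continuous) fun φ => ?_, fun h => ?_⟩
  · rw [← happly, h, Lp.toTemperedDistribution_apply]
  · ext φ
    rw [happly, Lp.toTemperedDistribution_apply]
    exact integral_congr_ae (h.mono fun ξ hξ => by simp only [hξ])

theorem integral_schwartz_smul_fourierInv (φ : 𝓢(E, ℂ)) {f : E → F} (hf : Integrable f) :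
    ∫ x, φ x • 𝓕⁻ f x = ∫ ξ, 𝓕⁻ φ ξ • f ξ := by
  have hflip : ∫ ξ, 𝓕 (φ : E → ℂ) ξ • f (-ξ) = ∫ x, φ x • 𝓕 (fun y => f (-y)) x := by
    simpa using! VectorFourier.integral_fourierIntegral_smul_eq_flip (L := innerₗ _)
      Real.continuous_fourierChar continuous_inner φ.integrable hf.comp_neg
  rw [Real.fourierInv_eq_fourier_comp_neg, ← hflip, ← integral_neg_eq_self]
  simp only [SchwartzMap.fourierInv_coe, Real.fourierInv_eq_fourier_neg, neg_neg]

theorem coeFn_fourierInv_ae_eq {H : Type*} [NormedAddCommGroup H] [InnerProductSpace ℂ H]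
    [CompleteSpace H] {f : E → H} (hf : Integrable f) {g : Lp H 2 (volume : Measure E)}
    (hg : g =ᵐ[volume] f) : (𝓕⁻ g : Lp H 2 (volume : Measure E)) =ᵐ[volume] 𝓕⁻ f := by
  refine ae_eq_of_integral_schwartz_smul_eq ((Lp.memLp _).locallyIntegrable one_le_two)
    (continuous_fourierInv_of_integrable hf).locallyIntegrable fun φ => ?_
  rw [integral_schwartz_smul_fourierInv φ hf, ← Lp.toTemperedDistribution_apply,
    ← Lp.fourierInv_toTemperedDistribution_eq, TemperedDistribution.fourierInv_apply,
    Lp.toTemperedDistribution_apply]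
  exact integral_congr_ae (hg.mono fun ξ hξ => by simp only [hξ])

end FourierTransform

section SobolevWeight

variable {E : Type*} [NormedAddCommGroup E]

/-- The weight `(1 + 4π²|ξ|²)^{s/2}` of the `H^s` norm. -/
noncomputable def sobolevWeight (s : ℝ) (ξ : E) : ℝ :=
  (1 + 4 * Real.pi ^ 2 * ‖ξ‖ ^ 2) ^ (s / 2)

theorem sobolevWeight_pos (s : ℝ) (ξ : E) : 0 < sobolevWeight s ξ :=
  Real.rpow_pos_of_pos (by positivity) _

theorem ofReal_sobolevWeight_ne_zero (s : ℝ) (ξ : E) : (sobolevWeight s ξ : ℂ) ≠ 0 :=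
  Complex.ofReal_ne_zero.mpr (sobolevWeight_pos s ξ).ne'

theorem sobolevWeight_neg (s : ℝ) (ξ : E) : sobolevWeight s (-ξ) = sobolevWeight s ξ := by
  rw [sobolevWeight, norm_neg, sobolevWeight]

theorem one_le_sobolevWeight {s : ℝ} (hs : 0 ≤ s) (ξ : E) : 1 ≤ sobolevWeight s ξ :=
  Real.one_le_rpow (le_add_of_nonneg_right (by positivity)) (by positivity)

theorem continuous_sobolevWeight (s : ℝ) : Continuous (sobolevWeight s : E → ℝ) :=
  Continuous.rpow_const (by fun_prop) fun _ => Or.inl (by positivity)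

theorem continuous_ofReal_sobolevWeight (s : ℝ) :
    Continuous fun ξ : E => (sobolevWeight s ξ : ℂ) :=
  Complex.continuous_ofReal.comp (continuous_sobolevWeight s)

theorem continuous_inv_ofReal_sobolevWeight (s : ℝ) :
    Continuous fun ξ : E => (sobolevWeight s ξ : ℂ)⁻¹ :=
  (continuous_ofReal_sobolevWeight s).inv₀ (ofReal_sobolevWeight_ne_zero s)

theorem rpow_one_add_norm_sq_le_sobolevWeight {s : ℝ} (hs : 0 ≤ s) (ξ : E) :
    (1 + ‖ξ‖ ^ 2) ^ (s / 2) ≤ sobolevWeight s ξ := by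
  have hpi : 1 ≤ 4 * Real.pi ^ 2 := by nlinarith [Real.pi_gt_three]
  refine Real.rpow_le_rpow (by positivity) ?_ (by positivity)
  nlinarith [sq_nonneg ‖ξ‖]

theorem sobolevWeight_le_rpow_one_add_norm_sq {s : ℝ} (hs : 0 ≤ s) (ξ : E) :
    sobolevWeight s ξ ≤ (4 * Real.pi ^ 2) ^ (s / 2) * (1 + ‖ξ‖ ^ 2) ^ (s / 2) := by
  rw [← Real.mul_rpow (by positivity) (by positivity)]
  refine Real.rpow_le_rpow (by positivity) ?_ (by positivity)
  nlinarith [Real.pi_gt_three]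

theorem norm_ofReal_sobolevWeight (s : ℝ) (ξ : E) : ‖(sobolevWeight s ξ : ℂ)‖ = sobolevWeight s ξ :=
  Complex.norm_of_nonneg (sobolevWeight_pos s ξ).le

theorem memLp_top_inv_sobolevWeight [MeasurableSpace E] [OpensMeasurableSpace E]
    [SecondCountableTopology E] {μ : Measure E} {s : ℝ} (hs : 0 ≤ s) :
    MemLp (fun ξ : E => (sobolevWeight s ξ : ℂ)⁻¹) ∞ μ := by
  refine memLp_top_of_bound (continuous_inv_ofReal_sobolevWeight s).aestronglyMeasurable 1
    (.of_forall fun ξ => ?_)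
  rw [norm_inv, norm_ofReal_sobolevWeight]
  exact inv_le_one_of_one_le₀ (one_le_sobolevWeight hs ξ)

end SobolevWeight

section SobolevEmbedding

variable {d : ℕ} {s : ℝ}

theorem memHs_iff_memLp_rpow_mul_fourier {f : L2 d} :
    MemHs s f ↔ MemLp (fun ξ => (((1 + ‖ξ‖ ^ 2) ^ (s / 2) : ℝ) : ℂ) * (𝓕 f : L2 d) ξ) 2 := by
  rw [MemHs, TemperedDistribution.memSobolev_iff_exists_smulLeftCLM_fourier,
    Lp.fourier_toTemperedDistribution_eq]
  simp only [smulLeftCLM_toTemperedDistribution_eq_iff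
    (m := fun ξ : EuclideanSpace ℝ (Fin d) => (((1 + ‖ξ‖ ^ 2) ^ (s / 2) : ℝ) : ℂ)) (by fun_prop)]
  exact ⟨fun ⟨g, hg⟩ => (memLp_congr_ae hg).mp (Lp.memLp g), fun h => ⟨h.toLp, h.coeFn_toLp⟩⟩

theorem memHs_iff_memLp_sobolevWeight_mul_fourier (hs : 0 ≤ s) {f : L2 d} :
    MemHs s f ↔ MemLp (fun ξ => (sobolevWeight s ξ : ℂ) * (𝓕 f : L2 d) ξ) 2 := by
  have hbracket (ξ : EuclideanSpace ℝ (Fin d)) :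
      ‖(((1 + ‖ξ‖ ^ 2) ^ (s / 2) : ℝ) : ℂ)‖ = (1 + ‖ξ‖ ^ 2) ^ (s / 2) :=
    Complex.norm_of_nonneg (by positivity)
  have hcont : Continuous fun ξ : EuclideanSpace ℝ (Fin d) =>
      (((1 + ‖ξ‖ ^ 2) ^ (s / 2) : ℝ) : ℂ) :=
    Complex.continuous_ofReal.comp
      (Continuous.rpow_const (by fun_prop) fun _ => Or.inl (by positivity))
  rw [memHs_iff_memLp_rpow_mul_fourier]
  refine ⟨fun h => h.of_le_mul (c := (4 * Real.pi ^ 2) ^ (s / 2)) ?_ (.of_forall fun ξ => ?_),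
    fun h => h.of_le ?_ (.of_forall fun ξ => ?_)⟩
  · exact (continuous_ofReal_sobolevWeight s).aestronglyMeasurable.mul (Lp.aestronglyMeasurable _)
  · rw [norm_mul, norm_mul, hbracket, norm_ofReal_sobolevWeight, ← mul_assoc]
    gcongr
    exact sobolevWeight_le_rpow_one_add_norm_sq hs ξ
  · exact hcont.aestronglyMeasurable.mul (Lp.aestronglyMeasurable _)
  · rw [norm_mul, norm_mul, hbracket, norm_ofReal_sobolevWeight]
    gcongr
    exact rpow_one_add_norm_sq_le_sobolevWeight hs ξ

/-- The operator `(1 - Δ)^{-s/2}` on `L²`. It is an isometry of `L²` onto `H^s`, through which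
`H^s` is identified with `L²` below. -/
noncomputable def sobolevEmb (hs : 0 ≤ s) : L2 d →L[ℂ] L2 d :=
  (Lp.fourierTransformₗᵢ (EuclideanSpace ℝ (Fin d)) ℂ).symm.toContinuousLinearEquiv ∘L
    boundedMul (memLp_top_inv_sobolevWeight hs)

theorem sobolevEmb_apply (hs : 0 ≤ s) (a : L2 d) :
    sobolevEmb hs a = 𝓕⁻ (boundedMul (memLp_top_inv_sobolevWeight hs) a) :=
  rfl

theorem fourier_sobolevEmb (hs : 0 ≤ s) (a : L2 d) :
    (𝓕 (sobolevEmb hs a) : L2 d) = boundedMul (memLp_top_inv_sobolevWeight hs) a :=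
  (Lp.fourierTransformₗᵢ (EuclideanSpace ℝ (Fin d)) ℂ).apply_symm_apply _

theorem sobolevWeight_mul_fourier_sobolevEmb (hs : 0 ≤ s) (a : L2 d) :
    (fun ξ => (sobolevWeight s ξ : ℂ) * (𝓕 (sobolevEmb hs a) : L2 d) ξ) =ᵐ[volume] a := by
  rw [fourier_sobolevEmb]
  filter_upwards [coeFn_boundedMul (memLp_top_inv_sobolevWeight hs) a] with ξ hξ
  rw [hξ, mul_inv_cancel_left₀ (ofReal_sobolevWeight_ne_zero s ξ)]

theorem hsNorm_sobolevEmb (hs : 0 ≤ s) (a : L2 d) : hsNorm s (sobolevEmb hs a) = ‖a‖ₑ :=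
  (eLpNorm_congr_ae (sobolevWeight_mul_fourier_sobolevEmb hs a)).trans (Lp.enorm_def a).symm

theorem hsNorm_sobolevEmb_sub (hs : 0 ≤ s) (a b : L2 d) :
    hsNorm s (sobolevEmb hs a - sobolevEmb hs b) = edist a b := by
  rw [← map_sub, hsNorm_sobolevEmb, edist_eq_enorm_sub]

theorem sobolevEmb_injective (hs : 0 ≤ s) : Function.Injective (sobolevEmb hs : L2 d → L2 d) := by
  intro a b hab
  rw [← edist_eq_zero, ← hsNorm_sobolevEmb_sub hs, hab, hsNorm_sobolevEmb_sub, edist_self]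

theorem memHs_sobolevEmb (hs : 0 ≤ s) (a : L2 d) : MemHs s (sobolevEmb hs a) :=
  (memHs_iff_memLp_sobolevWeight_mul_fourier hs).mpr
    ((memLp_congr_ae (sobolevWeight_mul_fourier_sobolevEmb hs a)).mpr (Lp.memLp a))

theorem MemHs.exists_sobolevEmb_eq (hs : 0 ≤ s) {f : L2 d} (hf : MemHs s f) :
    ∃ a, sobolevEmb hs a = f := by
  have hw := (memHs_iff_memLp_sobolevWeight_mul_fourier hs).mp hf
  refine ⟨hw.toLp, (Lp.fourierTransformₗᵢ (EuclideanSpace ℝ (Fin d)) ℂ).injective ?_⟩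
  change (𝓕 (sobolevEmb hs hw.toLp) : L2 d) = (𝓕 f : L2 d)
  rw [fourier_sobolevEmb]
  refine Lp.ext ?_
  filter_upwards [coeFn_boundedMul (memLp_top_inv_sobolevWeight hs) hw.toLp, hw.coeFn_toLp]
    with ξ hmul htoLp
  rw [hmul, htoLp, inv_mul_cancel_left₀ (ofReal_sobolevWeight_ne_zero s ξ)]

end SobolevEmbedding

section SchrodingerGroup

variable {d : ℕ} {s : ℝ}

/-- The symbol `e^{-iθ·4π²|ξ|²}` of `e^{iθΔ}`. -/
noncomputable def schrodingerSymbol (θ : ℝ) (ξ : EuclideanSpace ℝ (Fin d)) : ℂ :=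
  Complex.exp (-(Complex.I * ((θ * (4 * Real.pi ^ 2 * ‖ξ‖ ^ 2) : ℝ) : ℂ)))

theorem norm_schrodingerSymbol (θ : ℝ) (ξ : EuclideanSpace ℝ (Fin d)) :
    ‖schrodingerSymbol θ ξ‖ = 1 := by
  simp only [schrodingerSymbol, Complex.norm_exp, Complex.neg_re, Complex.I_mul_re,
    Complex.ofReal_im, neg_zero, Real.exp_zero]

theorem schrodingerSymbol_add (θ θ' : ℝ) (ξ : EuclideanSpace ℝ (Fin d)) :
    schrodingerSymbol (θ + θ') ξ = schrodingerSymbol θ ξ * schrodingerSymbol θ' ξ := by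
  rw [schrodingerSymbol, schrodingerSymbol, schrodingerSymbol, ← Complex.exp_add]
  push_cast
  ring_nf

theorem schrodingerSymbol_zero (ξ : EuclideanSpace ℝ (Fin d)) : schrodingerSymbol 0 ξ = 1 := by
  simp [schrodingerSymbol]

/-- Multiplication by the symbol of `e^{iθΔ}`: the operator `e^{iθΔ}` conjugated by
`𝓕 ∘ (1 - Δ)^{s/2}`, an isometry from `H^s` onto `L²`. -/
noncomputable def schrodingerMul (θ : ℝ) : L2 d →ₗᵢ[ℝ] L2 d where
  toLinearMap := (boundedMul (memLp_schrodingerSymbol d θ)).restrictScalars ℝ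
  norm_map' := norm_boundedMul _ (norm_schrodingerSymbol θ)

theorem coeFn_schrodingerMul (θ : ℝ) (a : L2 d) :
    schrodingerMul θ a =ᵐ[volume] fun ξ => schrodingerSymbol θ ξ * a ξ :=
  coeFn_boundedMul (memLp_schrodingerSymbol d θ) a

theorem isIsometryGroup_schrodingerMul :
    IsIsometryGroup (schrodingerMul : ℝ → L2 d →ₗᵢ[ℝ] L2 d) where
  map_zero a := by
    refine Lp.ext ?_
    filter_upwards [coeFn_schrodingerMul 0 a] with ξ h
    rw [h, schrodingerSymbol_zero, one_mul]
  map_add θ θ' a := by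
    refine Lp.ext ?_
    filter_upwards [coeFn_schrodingerMul (θ + θ') a, coeFn_schrodingerMul θ (schrodingerMul θ' a),
      coeFn_schrodingerMul θ' a] with ξ h h₁ h₂
    rw [h, h₁, h₂, schrodingerSymbol_add, mul_assoc]
  continuous_apply a := by
    refine continuous_boundedMul_apply (memLp_schrodingerSymbol d)
      (fun θ ξ => (norm_schrodingerSymbol θ ξ).le) (fun ξ => ?_) a
    fun_prop

theorem schrodingerOp_sobolevEmb (hs : 0 ≤ s) (θ : ℝ) (a : L2 d) :
    schrodingerOp θ (sobolevEmb hs a) = sobolevEmb hs (schrodingerMul θ a) := by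
  rw [schrodingerOp, toLp_smul_eq_boundedMul, fourier_sobolevEmb, sobolevEmb_apply]
  congr 1
  refine Lp.ext ?_
  filter_upwards [coeFn_boundedMul (memLp_schrodingerSymbol d θ)
      (boundedMul (memLp_top_inv_sobolevWeight hs) a),
    coeFn_boundedMul (memLp_top_inv_sobolevWeight hs) a, coeFn_schrodingerMul θ a,
    coeFn_boundedMul (memLp_top_inv_sobolevWeight hs) (schrodingerMul θ a)] with ξ h₁ h₂ h₃ h₄
  rw [h₁, h₂, h₄, h₃, schrodingerSymbol, mul_left_comm]

end SchrodingerGroup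

section WeightedConvolution

theorem sq_lintegral_mul_le {β : Type*} [MeasurableSpace β] {μ : Measure β} {f g : β → ℝ≥0∞}
    (hf : AEMeasurable f μ) (hg : AEMeasurable g μ) :
    (∫⁻ x, f x * g x ∂μ) ^ 2 ≤ (∫⁻ x, f x ^ 2 ∂μ) * ∫⁻ x, g x ^ 2 ∂μ := by
  calc (∫⁻ x, f x * g x ∂μ) ^ 2
      ≤ ((∫⁻ x, f x ^ (2 : ℝ) ∂μ) ^ (1 / 2 : ℝ) * (∫⁻ x, g x ^ (2 : ℝ) ∂μ) ^ (1 / 2 : ℝ)) ^ 2 :=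
        pow_le_pow_left' (ENNReal.lintegral_mul_le_Lp_mul_Lq μ Real.HolderConjugate.two_two hf hg) 2
    _ = (∫⁻ x, f x ^ 2 ∂μ) * ∫⁻ x, g x ^ 2 ∂μ := by
        simp only [mul_pow, ← ENNReal.rpow_two, ← ENNReal.rpow_mul]
        norm_num

theorem lintegral_lintegral_sub_mul {G : Type*} [AddGroup G] [MeasurableSpace G]
    [MeasurableAdd₂ G] [MeasurableNeg G] {μ : Measure G} [SFinite μ] [μ.IsAddRightInvariant]
    {f g : G → ℝ≥0∞} (hf : Measurable f) (hg : Measurable g) :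
    ∫⁻ ξ, ∫⁻ η, f η * g (ξ - η) ∂μ ∂μ = (∫⁻ η, f η ∂μ) * ∫⁻ η, g η ∂μ := by
  have hsub (η : G) : Measurable fun ξ => g (ξ - η) := hg.comp (measurable_id.sub_const η)
  rw [lintegral_lintegral_swap]
  · simp_rw [lintegral_const_mul _ (hsub _), lintegral_sub_right_eq_self]
    exact lintegral_mul_const _ hf
  · exact ((hf.comp measurable_snd).mul
      (hg.comp (measurable_fst.sub measurable_snd))).aemeasurable

theorem lintegral_sq_weighted_convolution_le {G : Type*} [AddGroup G] [MeasurableSpace G]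
    [MeasurableAdd₂ G] [MeasurableNeg G] {μ : Measure G} [SFinite μ] [μ.IsAddRightInvariant]
    {k : G → G → ℝ≥0∞} {f g : G → ℝ≥0∞} {C : ℝ≥0∞} (hk : ∀ ξ, Measurable (k ξ))
    (hC : ∀ ξ, ∫⁻ η, k ξ η ^ 2 ∂μ ≤ C) (hf : Measurable f) (hg : Measurable g) :
    ∫⁻ ξ, (∫⁻ η, k ξ η * (f η * g (ξ - η)) ∂μ) ^ 2 ∂μ ≤
      C * ((∫⁻ η, f η ^ 2 ∂μ) * ∫⁻ η, g η ^ 2 ∂μ) := by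
  have hfg (ξ : G) : Measurable fun η => f η * g (ξ - η) :=
    hf.mul (hg.comp (measurable_id.const_sub ξ))
  have hmeas : Measurable fun ξ => ∫⁻ η, f η ^ 2 * g (ξ - η) ^ 2 ∂μ :=
    Measurable.lintegral_prod_right' (f := fun p : G × G => f p.2 ^ 2 * g (p.1 - p.2) ^ 2)
      (((hf.comp measurable_snd).pow_const 2).mul
        ((hg.comp (measurable_fst.sub measurable_snd)).pow_const 2))
  calc ∫⁻ ξ, (∫⁻ η, k ξ η * (f η * g (ξ - η)) ∂μ) ^ 2 ∂μ
      ≤ ∫⁻ ξ, C * ∫⁻ η, f η ^ 2 * g (ξ - η) ^ 2 ∂μ ∂μ := by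
        refine lintegral_mono fun ξ => ?_
        refine (sq_lintegral_mul_le (hk ξ).aemeasurable (hfg ξ).aemeasurable).trans ?_
        simp_rw [mul_pow]
        gcongr
        exact hC ξ
    _ = C * ((∫⁻ η, f η ^ 2 ∂μ) * ∫⁻ η, g η ^ 2 ∂μ) := by
        rw [lintegral_const_mul _ hmeas,
          lintegral_lintegral_sub_mul (hf.pow_const 2) (hg.pow_const 2)]

end WeightedConvolution

section SobolevAlgebra

open scoped Convolution NNReal

section Kernel

variable {E : Type*} [NormedAddCommGroup E] {s : ℝ}

theorem sobolevWeight_sq (s : ℝ) (ξ : E) :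
    sobolevWeight s ξ ^ 2 = (1 + 4 * Real.pi ^ 2 * ‖ξ‖ ^ 2) ^ s := by
  rw [sobolevWeight, ← Real.rpow_mul_natCast (by positivity), Nat.cast_ofNat,
    div_mul_cancel₀ s two_ne_zero]

theorem sobolevWeight_add_sq_le (hs : 0 ≤ s) (ξ η : E) :
    sobolevWeight s (ξ + η) ^ 2 ≤ 4 ^ s * (sobolevWeight s ξ ^ 2 + sobolevWeight s η ^ 2) := by
  simp only [sobolevWeight_sq]
  set A := 1 + 4 * Real.pi ^ 2 * ‖ξ‖ ^ 2
  set B := 1 + 4 * Real.pi ^ 2 * ‖η‖ ^ 2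
  have hA : 0 ≤ A := by positivity
  have hB : 0 ≤ B := by positivity
  have hnorm : ‖ξ + η‖ ^ 2 ≤ 2 * (‖ξ‖ ^ 2 + ‖η‖ ^ 2) :=
    (pow_le_pow_left₀ (norm_nonneg _) (norm_add_le ξ η) 2).trans add_sq_le
  have hmax : 1 + 4 * Real.pi ^ 2 * ‖ξ + η‖ ^ 2 ≤ 4 * max A B := by
    have := mul_le_mul_of_nonneg_left hnorm (by positivity : 0 ≤ 4 * Real.pi ^ 2)
    linarith [le_max_left A B, le_max_right A B]
  calc (1 + 4 * Real.pi ^ 2 * ‖ξ + η‖ ^ 2) ^ s ≤ (4 * max A B) ^ s := by gcongr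
    _ = 4 ^ s * max (A ^ s) (B ^ s) := by
        rw [Real.mul_rpow zero_le_four (hA.trans (le_max_left A B)),
          (Real.monotoneOn_rpow_Ici_of_exponent_nonneg hs).map_max hA hB]
    _ ≤ 4 ^ s * (A ^ s + B ^ s) := by
        gcongr
        exact max_le_add_of_nonneg (by positivity) (by positivity)

/-- The kernel which the multiplication of functions induces on their Fourier transforms, when
these are normalised by the weight of the `H^s` norm. -/
noncomputable def sobolevKernel (s : ℝ) (ξ η : E) : ℂ :=
  sobolevWeight s ξ * ((sobolevWeight s η : ℂ)⁻¹ * (sobolevWeight s (ξ - η) : ℂ)⁻¹)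

theorem continuous_sobolevKernel (s : ℝ) (ξ : E) : Continuous (sobolevKernel s ξ) :=
  continuous_const.mul ((continuous_inv_ofReal_sobolevWeight s).mul
    ((continuous_inv_ofReal_sobolevWeight s).comp (continuous_sub_left ξ)))

theorem norm_sobolevKernel_sq_le (hs : 0 ≤ s) (ξ η : E) :
    ‖sobolevKernel s ξ η‖ ^ 2 ≤
      4 ^ s * (‖(sobolevWeight s η : ℂ)⁻¹‖ ^ 2 + ‖(sobolevWeight s (ξ - η) : ℂ)⁻¹‖ ^ 2) := by
  simp only [sobolevKernel, norm_mul, norm_inv, norm_ofReal_sobolevWeight, mul_pow]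
  have hη := sobolevWeight_pos s η
  have hξη := sobolevWeight_pos s (ξ - η)
  have hle := sobolevWeight_add_sq_le hs η (ξ - η)
  rw [add_sub_cancel] at hle
  calc sobolevWeight s ξ ^ 2 * ((sobolevWeight s η)⁻¹ ^ 2 * (sobolevWeight s (ξ - η))⁻¹ ^ 2)
      ≤ 4 ^ s * (sobolevWeight s η ^ 2 + sobolevWeight s (ξ - η) ^ 2) *
        ((sobolevWeight s η)⁻¹ ^ 2 * (sobolevWeight s (ξ - η))⁻¹ ^ 2) := by gcongr
    _ = 4 ^ s * ((sobolevWeight s η)⁻¹ ^ 2 + (sobolevWeight s (ξ - η))⁻¹ ^ 2) := by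
        field_simp
        ring

theorem enorm_sobolevKernel_sq_le (hs : 0 ≤ s) (ξ η : E) :
    ‖sobolevKernel s ξ η‖ₑ ^ 2 ≤ ENNReal.ofReal (4 ^ s) *
      (‖(sobolevWeight s η : ℂ)⁻¹‖ₑ ^ 2 + ‖(sobolevWeight s (ξ - η) : ℂ)⁻¹‖ₑ ^ 2) := by
  simp only [← ofReal_norm, ← ENNReal.ofReal_pow (norm_nonneg _)]
  rw [← ENNReal.ofReal_add (by positivity) (by positivity), ← ENNReal.ofReal_mul (by positivity)]
  exact ENNReal.ofReal_le_ofReal (norm_sobolevKernel_sq_le hs ξ η)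

variable [NormedSpace ℝ E] [FiniteDimensional ℝ E] [MeasurableSpace E] [BorelSpace E]
  {μ : Measure E} [μ.IsAddHaarMeasure]

theorem memLp_two_inv_sobolevWeight (hs : 0 ≤ s) (hds : (Module.finrank ℝ E : ℝ) / 2 < s) :
    MemLp (fun ξ : E => (sobolevWeight s ξ : ℂ)⁻¹) 2 μ := by
  have hmeas := (continuous_inv_ofReal_sobolevWeight (E := E) s).aestronglyMeasurable (μ := μ)
  rw [memLp_two_iff_integrable_sq_norm hmeas]
  have hint := integrable_rpow_neg_one_add_norm_sq (E := E) (μ := μ) (r := 2 * s) (by linarith)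
  refine hint.mono' (hmeas.norm.pow 2) (.of_forall fun ξ => ?_)
  have hle := pow_le_pow_left₀ (by positivity) (rpow_one_add_norm_sq_le_sobolevWeight hs ξ) 2
  rw [← Real.rpow_mul_natCast (by positivity), Nat.cast_ofNat, div_mul_cancel₀ s two_ne_zero]
    at hle
  rw [norm_pow, norm_norm, norm_inv, norm_ofReal_sobolevWeight, inv_pow, neg_div,
    mul_div_cancel_left₀ s two_ne_zero, Real.rpow_neg (by positivity)]
  exact inv_anti₀ (by positivity) hle

theorem exists_lintegral_enorm_sobolevKernel_sq_le (hs : 0 ≤ s)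
    (hds : (Module.finrank ℝ E : ℝ) / 2 < s) :
    ∃ C : ℝ≥0, ∀ ξ : E, ∫⁻ η, ‖sobolevKernel s ξ η‖ₑ ^ 2 ∂μ ≤ C := by
  set w : E → ℂ := fun η => (sobolevWeight s η : ℂ)⁻¹
  have hw : Measurable fun η => ‖w η‖ₑ ^ 2 :=
    ((continuous_inv_ofReal_sobolevWeight s).measurable.enorm).pow_const 2
  have hfin : ENNReal.ofReal (4 ^ s) * (eLpNorm w 2 μ ^ 2 + eLpNorm w 2 μ ^ 2) ≠ ∞ := by
    have := (memLp_two_inv_sobolevWeight (μ := μ) hs hds).eLpNorm_ne_top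
    finiteness
  refine ⟨(ENNReal.ofReal (4 ^ s) * (eLpNorm w 2 μ ^ 2 + eLpNorm w 2 μ ^ 2)).toNNReal,
    fun ξ => ?_⟩
  calc ∫⁻ η, ‖sobolevKernel s ξ η‖ₑ ^ 2 ∂μ
      ≤ ∫⁻ η, ENNReal.ofReal (4 ^ s) * (‖w η‖ₑ ^ 2 + ‖w (ξ - η)‖ₑ ^ 2) ∂μ :=
        lintegral_mono fun η => enorm_sobolevKernel_sq_le hs ξ η
    _ = ENNReal.ofReal (4 ^ s) * (eLpNorm w 2 μ ^ 2 + eLpNorm w 2 μ ^ 2) := by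
        rw [lintegral_const_mul' _ _ ENNReal.ofReal_ne_top, lintegral_add_left hw,
          lintegral_sub_left_eq_self (fun η => ‖w η‖ₑ ^ 2) ξ, eLpNorm_two_sq_eq_lintegral]
    _ = _ := (ENNReal.coe_toNNReal hfin).symm

end Kernel

variable {d : ℕ} {s : ℝ}

theorem integrable_inv_sobolevWeight_mul (hs : 0 ≤ s) (hds : (d : ℝ) / 2 < s) (a : L2 d) :
    Integrable fun ξ => (sobolevWeight s ξ : ℂ)⁻¹ * a ξ :=
  (memLp_two_inv_sobolevWeight hs (by simpa using hds)).integrable_mul (Lp.memLp a)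

theorem coeFn_sobolevEmb (hs : 0 ≤ s) (hds : (d : ℝ) / 2 < s) (a : L2 d) :
    sobolevEmb hs a =ᵐ[volume] 𝓕⁻ fun ξ => (sobolevWeight s ξ : ℂ)⁻¹ * a ξ :=
  coeFn_fourierInv_ae_eq (integrable_inv_sobolevWeight_mul hs hds a)
    (coeFn_boundedMul (memLp_top_inv_sobolevWeight hs) a)

theorem enorm_sobolevWeight_mul_convolution_le (a b : L2 d) (ξ : EuclideanSpace ℝ (Fin d)) :
    ‖(sobolevWeight s ξ : ℂ) * ((fun η => (sobolevWeight s η : ℂ)⁻¹ * a η)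
      ⋆[ContinuousLinearMap.mul ℂ ℂ] fun η => (sobolevWeight s η : ℂ)⁻¹ * b η) ξ‖ₑ ≤
      ∫⁻ η, ‖sobolevKernel s ξ η‖ₑ * (‖a η‖ₑ * ‖b (ξ - η)‖ₑ) := by
  rw [convolution_def, ← integral_const_mul]
  refine (enorm_integral_le_lintegral_enorm _).trans_eq (lintegral_congr fun η => ?_)
  rw [← enorm_mul, ← enorm_mul, sobolevKernel, ContinuousLinearMap.mul_apply']
  ring_nf

theorem exists_eLpNorm_sobolevWeight_mul_convolution_le (hs : 0 ≤ s) (hds : (d : ℝ) / 2 < s) :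
    ∃ K : ℝ≥0, ∀ a b : L2 d,
      eLpNorm (fun ξ => (sobolevWeight s ξ : ℂ) * ((fun η => (sobolevWeight s η : ℂ)⁻¹ * a η)
        ⋆[ContinuousLinearMap.mul ℂ ℂ] fun η => (sobolevWeight s η : ℂ)⁻¹ * b η) ξ) 2 volume ≤
      K * ‖a‖ₑ * ‖b‖ₑ := by
  obtain ⟨C, hC⟩ := exists_lintegral_enorm_sobolevKernel_sq_le
    (E := EuclideanSpace ℝ (Fin d)) (μ := volume) hs (by simpa using hds)
  refine ⟨NNReal.sqrt C, fun a b => (ENNReal.pow_le_pow_left_iff two_ne_zero).mp ?_⟩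
  rw [eLpNorm_two_sq_eq_lintegral]
  calc _ ≤ ∫⁻ ξ, (∫⁻ η, ‖sobolevKernel s ξ η‖ₑ * (‖a η‖ₑ * ‖b (ξ - η)‖ₑ)) ^ 2 :=
        lintegral_mono fun ξ =>
          pow_le_pow_left' (enorm_sobolevWeight_mul_convolution_le a b ξ) 2
    _ ≤ C * ((∫⁻ η, ‖a η‖ₑ ^ 2) * ∫⁻ η, ‖b η‖ₑ ^ 2) :=
        lintegral_sq_weighted_convolution_le
          (fun ξ => (continuous_sobolevKernel s ξ).measurable.enorm) hC
          (Lp.stronglyMeasurable a).measurable.enorm (Lp.stronglyMeasurable b).measurable.enorm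
    _ = (NNReal.sqrt C * ‖a‖ₑ * ‖b‖ₑ) ^ 2 := by
        rw [← eLpNorm_two_sq_eq_lintegral, ← eLpNorm_two_sq_eq_lintegral, ← Lp.enorm_def,
          ← Lp.enorm_def, mul_pow, mul_pow, ← ENNReal.coe_pow, NNReal.sq_sqrt, mul_assoc]

theorem fourierInv_mul_fourierInv {E : Type*} [NormedAddCommGroup E] [InnerProductSpace ℝ E]
    [FiniteDimensional ℝ E] [MeasurableSpace E] [BorelSpace E] {f g : E → ℂ}
    (hf : Integrable f) (hg : Integrable g) :
    𝓕⁻ f * 𝓕⁻ g = 𝓕⁻ (f ⋆[ContinuousLinearMap.mul ℂ ℂ] g) := by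
  ext x
  simp only [Pi.mul_apply, Real.fourierInv_eq_fourier_neg, Real.fourier_mul_convolution_eq hf hg]

theorem exists_sobolevEmb_ae_eq_mul (hs : 0 ≤ s) (hds : (d : ℝ) / 2 < s) :
    ∃ K : ℝ, ∀ a b : L2 d, ∃ c : L2 d, ‖c‖ ≤ K * ‖a‖ * ‖b‖ ∧
      sobolevEmb hs c =ᵐ[volume] fun x => sobolevEmb hs a x * sobolevEmb hs b x := by
  obtain ⟨K, hK⟩ := exists_eLpNorm_sobolevWeight_mul_convolution_le hs hds
  refine ⟨K, fun a b => ?_⟩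
  have ha := integrable_inv_sobolevWeight_mul hs hds a
  have hb := integrable_inv_sobolevWeight_mul hs hds b
  set h := (fun η => (sobolevWeight s η : ℂ)⁻¹ * a η)
    ⋆[ContinuousLinearMap.mul ℂ ℂ] fun η => (sobolevWeight s η : ℂ)⁻¹ * b η
  have hbound : (K * ‖a‖ₑ * ‖b‖ₑ : ℝ≥0∞) < ∞ := by finiteness
  have hmem : MemLp (fun ξ => (sobolevWeight s ξ : ℂ) * h ξ) 2 :=
    ⟨(continuous_ofReal_sobolevWeight s).aestronglyMeasurable.mul
      (ha.integrable_convolution _ hb).1, (hK a b).trans_lt hbound⟩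
  refine ⟨hmem.toLp, ?_, (coeFn_sobolevEmb hs hds _).trans ?_⟩
  · rw [Lp.norm_toLp]
    refine (ENNReal.toReal_mono hbound.ne (hK a b)).trans_eq ?_
    simp only [ENNReal.toReal_mul, ENNReal.coe_toReal, toReal_enorm]
  · have htoLp : 𝓕⁻ (fun ξ => (sobolevWeight s ξ : ℂ)⁻¹ * hmem.toLp _ ξ) = 𝓕⁻ h := by
      ext x
      refine Real.fourierInv_congr_ae (hmem.coeFn_toLp.mono fun ξ hξ => ?_) x
      simp only [hξ, inv_mul_cancel_left₀ (ofReal_sobolevWeight_ne_zero s ξ)]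
    rw [htoLp, ← fourierInv_mul_fourierInv ha hb]
    exact ((coeFn_sobolevEmb hs hds a).mul (coeFn_sobolevEmb hs hds b)).symm

theorem coeFn_sobolevEmb_add (hs : 0 ≤ s) (a b : L2 d) :
    sobolevEmb hs (a + b) =ᵐ[volume] fun x => sobolevEmb hs a x + sobolevEmb hs b x := by
  rw [map_add]
  exact Lp.coeFn_add _ _

theorem coeFn_sobolevEmb_smul (hs : 0 ≤ s) (z : ℂ) (a : L2 d) :
    sobolevEmb hs (z • a) =ᵐ[volume] fun x => z * sobolevEmb hs a x := by
  rw [map_smul]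
  exact Lp.coeFn_smul _ _

theorem exists_sobolevMul (hs : 0 ≤ s) (hds : (d : ℝ) / 2 < s) :
    ∃ M : L2 d →L[ℂ] L2 d →L[ℂ] L2 d, ∀ a b,
      sobolevEmb hs (M a b) =ᵐ[volume] fun x => sobolevEmb hs a x * sobolevEmb hs b x := by
  obtain ⟨K, hK⟩ := exists_sobolevEmb_ae_eq_mul (d := d) hs hds
  choose m hm_norm hm using hK
  have m_eq {a b c : L2 d}
      (h : sobolevEmb hs c =ᵐ[volume] fun x => sobolevEmb hs a x * sobolevEmb hs b x) :
      m a b = c := sobolevEmb_injective hs (Lp.ext ((hm a b).trans h.symm))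
  refine ⟨LinearMap.mkContinuous₂ (LinearMap.mk₂ ℂ m (fun a a' b => m_eq ?_)
    (fun z a b => m_eq ?_) (fun a b b' => m_eq ?_) (fun z a b => m_eq ?_)) K hm_norm, hm⟩
  · filter_upwards [coeFn_sobolevEmb_add hs (m a b) (m a' b), hm a b, hm a' b,
      coeFn_sobolevEmb_add hs a a'] with x hsum h h' hadd
    rw [hsum, h, h', hadd, add_mul]
  · filter_upwards [coeFn_sobolevEmb_smul hs z (m a b), hm a b, coeFn_sobolevEmb_smul hs z a]
      with x hprod h hsmul
    rw [hprod, h, hsmul, mul_assoc]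
  · filter_upwards [coeFn_sobolevEmb_add hs (m a b) (m a b'), hm a b, hm a b',
      coeFn_sobolevEmb_add hs b b'] with x hsum h h' hadd
    rw [hsum, h, h', hadd, mul_add]
  · filter_upwards [coeFn_sobolevEmb_smul hs z (m a b), hm a b, coeFn_sobolevEmb_smul hs z b]
      with x hprod h hsmul
    rw [hprod, h, hsmul, mul_left_comm]

theorem fourierInv_conj_comp_neg {E : Type*} [NormedAddCommGroup E] [InnerProductSpace ℝ E]
    [FiniteDimensional ℝ E] [MeasurableSpace E] [BorelSpace E] (f : E → ℂ) (x : E) :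
    𝓕⁻ (fun ξ => starRingEnd ℂ (f (-ξ))) x = starRingEnd ℂ (𝓕⁻ f x) := by
  rw [Real.fourierInv_eq, Real.fourierInv_eq, ← integral_conj, ← integral_neg_eq_self]
  simp only [neg_neg, inner_neg_left, AddChar.map_neg_eq_inv, Circle.smul_def,
    Circle.coe_inv_eq_conj, smul_eq_mul, map_mul]

/-- The map `a ↦ conj (a (-·))` of `L²`: complex conjugation, seen on the Fourier side. -/
noncomputable def conjNeg : L2 d →L[ℝ] L2 d :=
  Complex.conjCLE.toContinuousLinearMap.compLpL 2 volume ∘L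
    (Lp.compMeasurePreservingₗᵢ ℝ Neg.neg
      (Measure.measurePreserving_neg volume)).toContinuousLinearMap

theorem coeFn_conjNeg (a : L2 d) :
    conjNeg a =ᵐ[volume] fun ξ => starRingEnd ℂ (a (-ξ)) := by
  have hneg := Measure.measurePreserving_neg (volume : Measure (EuclideanSpace ℝ (Fin d)))
  filter_upwards [Complex.conjCLE.toContinuousLinearMap.coeFn_compLpL
    (Lp.compMeasurePreservingₗᵢ ℝ Neg.neg hneg a), Lp.coeFn_compMeasurePreserving a hneg]
    with ξ hconj hcomp
  exact hconj.trans (congrArg _ hcomp)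

theorem coeFn_sobolevEmb_conjNeg (hs : 0 ≤ s) (hds : (d : ℝ) / 2 < s) (a : L2 d) :
    sobolevEmb hs (conjNeg a) =ᵐ[volume] fun x => starRingEnd ℂ (sobolevEmb hs a x) := by
  filter_upwards [coeFn_sobolevEmb hs hds (conjNeg a), coeFn_sobolevEmb hs hds a] with x h h'
  rw [h, h', ← fourierInv_conj_comp_neg]
  refine Real.fourierInv_congr_ae ((coeFn_conjNeg a).mono fun ξ hξ => ?_) x
  simp only [hξ, map_mul, map_inv₀, Complex.conj_ofReal, sobolevWeight_neg]

theorem exists_powerNL_sobolevEmb_eq (hs : 0 ≤ s) (hds : (d : ℝ) / 2 < s) (α : ℕ) :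
    ∃ N : L2 d → L2 d, IsLipschitzOnBalls N ∧
      ∀ a, powerNL α (sobolevEmb hs a) = sobolevEmb hs (N a) := by
  suffices h : ∃ N : L2 d → L2 d, IsLipschitzOnBalls N ∧ ∀ a, sobolevEmb hs (N a) =ᵐ[volume]
      fun x => ((‖sobolevEmb hs a x‖ ^ (2 * α) : ℝ) : ℂ) * sobolevEmb hs a x by
    obtain ⟨N, hN, hNα⟩ := h
    refine ⟨N, hN, fun a => ?_⟩
    rw [powerNL, dif_pos ((memLp_congr_ae (hNα a)).mp (Lp.memLp _))]
    exact Lp.ext ((MemLp.coeFn_toLp _).trans (hNα a).symm)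
  obtain ⟨M, hM⟩ := exists_sobolevMul (d := d) hs hds
  have hid : IsLipschitzOnBalls (id : L2 d → L2 d) := .of_lipschitzWith LipschitzWith.id
  have hconj : IsLipschitzOnBalls (conjNeg : L2 d → L2 d) :=
    .of_lipschitzWith conjNeg.lipschitz
  induction α with
  | zero => exact ⟨id, hid, fun a => by simp⟩
  | succ α ih =>
    obtain ⟨N, hN, hNα⟩ := ih
    -- `|u|^{2(α+1)} u = (u * conj u) * |u|^{2α} u`
    refine ⟨fun a => M (M a (conjNeg a)) (N a), .bilinear M (.bilinear M hid hconj) hN,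
      fun a => ?_⟩
    filter_upwards [hM (M a (conjNeg a)) (N a), hM a (conjNeg a),
      coeFn_sobolevEmb_conjNeg hs hds a, hNα a] with x hprod hsq hbar hpow
    rw [hprod, hsq, hbar, hpow, Complex.mul_conj, Complex.normSq_eq_norm_sq, mul_add, pow_add]
    push_cast
    ring

end SobolevAlgebra

section SobolevSolutions

variable {d σ α : ℕ} {hs : (0 : ℝ) ≤ σ} {N : L2 d → L2 d} {g : ℝ → ℝ} {t₀ : ℝ} {a : L2 d}

theorem schrodingerMul_I_smul (θ : ℝ) (a : L2 d) :
    schrodingerMul θ (Complex.I • a) = Complex.I • schrodingerMul θ a :=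
  (boundedMul (memLp_schrodingerSymbol d θ)).map_smul Complex.I a

theorem integral_schrodingerOp_powerNL_eq (hN : Continuous N)
    (hNα : ∀ a, powerNL α (sobolevEmb hs a) = sobolevEmb hs (N a))
    (hg : ∀ a b, IntervalIntegrable g volume a b) {t : ℝ} (ht : t₀ ≤ t) {u w : ℝ → L2 d}
    (hw : ContinuousOn w (Icc t₀ t)) (huw : EqOn u (fun r => sobolevEmb hs (w r)) (Icc t₀ t)) :
    Complex.I • ∫ r in t₀..t, schrodingerOp (∫ τ in r..t, g τ) (powerNL α (u r)) =
      sobolevEmb hs (∫ r in t₀..t, schrodingerMul (∫ τ in r..t, g τ) (Complex.I • N (w r))) := by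
  have hθ : Continuous fun r => ∫ τ in r..t, g τ := by
    simp_rw [fun r => intervalIntegral.integral_symm (f := g) (μ := volume) t r]
    exact (intervalIntegral.continuous_primitive hg t).neg
  have hint : IntervalIntegrable
      (fun r => schrodingerMul (∫ τ in r..t, g τ) (Complex.I • N (w r))) volume t₀ t :=
    (isIsometryGroup_schrodingerMul.continuous_uncurry.comp_continuousOn (hθ.continuousOn.prodMk
      ((hN.comp_continuousOn hw).const_smul Complex.I))).intervalIntegrable_of_Icc ht
  rw [← intervalIntegral.integral_smul, ← (sobolevEmb hs).intervalIntegral_comp_comm hint]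
  refine intervalIntegral.integral_congr fun r hr => ?_
  rw [uIcc_of_le ht] at hr
  simp only [huw hr, hNα, schrodingerOp_sobolevEmb, schrodingerMul_I_smul, map_smul]

theorem isNLSSolution_iff_isMildSolution (hN : Continuous N)
    (hNα : ∀ a, powerNL α (sobolevEmb hs a) = sobolevEmb hs (N a))
    (hg : ∀ a b, IntervalIntegrable g volume a b) {J : Set ℝ} (hJ : J.OrdConnected)
    (ht₀ : IsLeast J t₀) {u w : ℝ → L2 d} (huw : EqOn u (fun t => sobolevEmb hs (w t)) J) :
    IsNLSSolution σ α g t₀ (sobolevEmb hs a) J u ↔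
      IsMildSolution schrodingerMul (fun x => Complex.I • N x) g t₀ a J w := by
  have hcont : (∀ t ∈ J, Tendsto (fun r => hsNorm σ (u r - u t)) (𝓝[J] t) (𝓝 0)) ↔
      ContinuousOn w J := forall₂_congr fun t ht => by
    rw [ContinuousWithinAt, tendsto_iff_edist_tendsto_0]
    refine tendsto_congr' ?_
    filter_upwards [self_mem_nhdsWithin] with r hr
    rw [huw hr, huw ht, hsNorm_sobolevEmb_sub]
  have hduhamel (hw : ContinuousOn w J) (t : ℝ) (ht : t ∈ J) :
      u t = schrodingerOp (∫ τ in t₀..t, g τ) (sobolevEmb hs a) +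
        Complex.I • ∫ r in t₀..t, schrodingerOp (∫ τ in r..t, g τ) (powerNL α (u r)) ↔
      w t = schrodingerMul (∫ τ in t₀..t, g τ) a +
        ∫ r in t₀..t, schrodingerMul (∫ τ in r..t, g τ) (Complex.I • N (w r)) := by
    have hsub : Icc t₀ t ⊆ J := hJ.out ht₀.1 ht
    rw [integral_schrodingerOp_powerNL_eq hN hNα hg (ht₀.2 ht) (hw.mono hsub) (huw.mono hsub),
      schrodingerOp_sobolevEmb, ← map_add, huw ht, (sobolevEmb_injective hs).eq_iff]
  refine ⟨fun h => ⟨hcont.mp h.cont, fun t ht => ?_⟩,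
    fun h => ⟨fun t ht => ?_, hcont.mpr h.continuousOn, fun t ht => ?_⟩⟩
  · exact (hduhamel (hcont.mp h.cont) t ht).mp (h.duhamel t ht)
  · exact huw ht ▸ memHs_sobolevEmb hs (w t)
  · exact (hduhamel h.continuousOn t ht).mpr (h.duhamel t ht)

/-- The function in `H^σ` which corresponds to `b` in the interaction picture, where `H^σ` is
identified with `L²` through `sobolevEmb`. -/
noncomputable def fromInteraction (hs : (0 : ℝ) ≤ σ) (g : ℝ → ℝ) (t₀ : ℝ) (b : ℝ → L2 d)
    (t : ℝ) : L2 d :=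
  sobolevEmb hs (schrodingerMul (∫ τ in t₀..t, g τ) (b t))

/-- The field of the nonlinear Schrödinger equation in the interaction picture. -/
noncomputable def nlsField (N : L2 d → L2 d) (g : ℝ → ℝ) (t₀ t : ℝ) : L2 d → L2 d :=
  interactionField schrodingerMul (fun x => Complex.I • N x) (∫ τ in t₀..t, g τ)

theorem exists_eqOn_fromInteraction (hs : (0 : ℝ) ≤ σ) (g : ℝ → ℝ) (t₀ : ℝ) {J : Set ℝ}
    {u : ℝ → L2 d} (hu : ∀ t ∈ J, MemHs σ (u t)) : ∃ b, EqOn u (fromInteraction hs g t₀ b) J := by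
  choose! w hw using fun t ht => (hu t ht).exists_sobolevEmb_eq hs
  refine ⟨fun t => schrodingerMul (-∫ τ in t₀..t, g τ) (w t), fun t ht => ?_⟩
  rw [fromInteraction, isIsometryGroup_schrodingerMul.apply_neg_apply, hw t ht]

theorem isNLSSolution_iff_isIntegralSolution (hN : Continuous N)
    (hNα : ∀ a, powerNL α (sobolevEmb hs a) = sobolevEmb hs (N a))
    (hg : ∀ a b, IntervalIntegrable g volume a b) {J : Set ℝ} (hJ : J.OrdConnected)
    (ht₀ : IsLeast J t₀) {u b : ℝ → L2 d} (hub : EqOn u (fromInteraction hs g t₀ b) J) :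
    IsNLSSolution σ α g t₀ (sobolevEmb hs a) J u ↔
      IsIntegralSolution (nlsField N g t₀) t₀ a J b :=
  (isNLSSolution_iff_isMildSolution hN hNα hg hJ ht₀ hub).trans
    (isMildSolution_iff_isIntegralSolution isIsometryGroup_schrodingerMul
      (hN.const_smul Complex.I) hg hJ ht₀)

theorem isLeast_setOf_coe_lt {Tmax : EReal} (h : (t₀ : EReal) < Tmax) :
    IsLeast {t : ℝ | t₀ ≤ t ∧ (t : EReal) < Tmax} t₀ :=
  ⟨⟨le_rfl, h⟩, fun _ ht => ht.1⟩

theorem ordConnected_setOf_coe_lt {Tmax : EReal} :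
    {t : ℝ | t₀ ≤ t ∧ (t : EReal) < Tmax}.OrdConnected :=
  ⟨fun _ hx _ hy _ ht => Icc_subset_setOf_coe_lt hy.2 ⟨hx.1.trans ht.1, ht.2⟩⟩

theorem hsNorm_fromInteraction (b : ℝ → L2 d) (t : ℝ) :
    hsNorm σ (fromInteraction hs g t₀ b t) = ENNReal.ofReal ‖b t‖ := by
  rw [fromInteraction, hsNorm_sobolevEmb, ← ofReal_norm, LinearIsometry.norm_map]

theorem isMaximalNLSSolution_iff_isMaximalIntegralSolution (hN : Continuous N)
    (hNα : ∀ a, powerNL α (sobolevEmb hs a) = sobolevEmb hs (N a))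
    (hg : ∀ a b, IntervalIntegrable g volume a b) {Tmax : EReal} {u b : ℝ → L2 d}
    (hub : EqOn u (fromInteraction hs g t₀ b) {t : ℝ | t₀ ≤ t ∧ (t : EReal) < Tmax}) :
    IsMaximalNLSSolution σ α g t₀ (sobolevEmb hs a) Tmax u ↔
      IsMaximalIntegralSolution (nlsField N g t₀) t₀ a Tmax b := by
  have hsol (hlt : (t₀ : EReal) < Tmax) := isNLSSolution_iff_isIntegralSolution (a := a) hN hNα hg
    ordConnected_setOf_coe_lt (isLeast_setOf_coe_lt hlt) hub
  have hblowup (hlt : (t₀ : EReal) < Tmax) (T : ℝ) (hT : Tmax = T) :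
      Tendsto (fun t => hsNorm σ (u t)) (𝓝[<] T) (𝓝 ∞) ↔
        Tendsto (fun t => ‖b t‖) (𝓝[<] T) atTop := by
    rw [← ENNReal.tendsto_ofReal_nhds_top]
    refine tendsto_congr' ?_
    subst hT
    filter_upwards [Ioo_mem_nhdsLT (EReal.coe_lt_coe_iff.mp hlt)] with t ht
    rw [hub ⟨ht.1.le, EReal.coe_lt_coe_iff.mpr ht.2⟩, hsNorm_fromInteraction]
  exact ⟨fun h => ⟨h.lt, (hsol h.lt).mp h.isSolution,
      fun T hT => (hblowup h.lt T hT).mp (h.blowup T hT)⟩,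
    fun h => ⟨h.lt, (hsol h.lt).mpr h.isSolution,
      fun T hT => (hblowup h.lt T hT).mpr (h.blowup T hT)⟩⟩

theorem hasUniqueMaximalNLSSolution_of_isLipschitzOnBalls (hN : IsLipschitzOnBalls N)
    (hNα : ∀ a, powerNL α (sobolevEmb hs a) = sobolevEmb hs (N a))
    (hg : ∀ a b, IntervalIntegrable g volume a b) :
    HasUniqueMaximalNLSSolution σ α g t₀ (sobolevEmb hs a) := by
  have hfield : IsUniformLipschitzField (nlsField N g t₀) :=
    isUniformLipschitzField_interactionField isIsometryGroup_schrodingerMul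
      (.lipschitz_comp (lipschitzWith_smul Complex.I) hN)
      (intervalIntegral.continuous_primitive hg t₀)
  obtain ⟨Tmax, b, hb, huniq⟩ := hfield.exists_isMaximalIntegralSolution t₀ a
  refine ⟨Tmax, fromInteraction hs g t₀ b, (isMaximalNLSSolution_iff_isMaximalIntegralSolution
    hN.continuous hNα hg fun _ _ => rfl).mpr hb, fun T v hT hv => ?_⟩
  obtain ⟨c, hvc⟩ := exists_eqOn_fromInteraction hs g t₀ hv.mem
  obtain ⟨hTmax, hcb⟩ := huniq T c hT.le ((isNLSSolution_iff_isIntegralSolution hN.continuous hNα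
    hg ordConnected_Icc (isLeast_Icc hT.le) hvc).mp hv)
  refine ⟨hTmax, fun t ht => ?_⟩
  rw [hvc ht, fromInteraction, hcb ht, fromInteraction]

theorem tendsto_iSup_edist_of_tendstoUniformlyOn {ι β X : Type*} [PseudoEMetricSpace X]
    {l : Filter ι} {f : ι → β → X} {f₀ : β → X} {K : Set β} (h : TendstoUniformlyOn f f₀ l K) :
    Tendsto (fun i => ⨆ t ∈ K, edist (f i t) (f₀ t)) l (𝓝 0) := by
  refine ENNReal.tendsto_nhds_zero.mpr fun η hη => ?_
  filter_upwards [EMetric.tendstoUniformlyOn_iff.mp h η hη] with i hi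
  exact iSup₂_le fun t ht => edist_comm (f i t) (f₀ t) ▸ (hi t ht).le

theorem eventually_coe_lt_and_tendsto_iSup_hsNorm_sub (hN : IsLipschitzOnBalls N)
    (hNα : ∀ a, powerNL α (sobolevEmb hs a) = sobolevEmb hs (N a)) {ι : Type*} {l : Filter ι}
    {g₀ : ℝ → ℝ} {g : ι → ℝ → ℝ} (hg₀ : ∀ a b, IntervalIntegrable g₀ volume a b)
    (hg : ∀ i a b, IntervalIntegrable (g i) volume a b) {T : ℝ}
    (hlim : TendstoUniformlyOn (fun i t => ∫ τ in t₀..t, g i τ) (fun t => ∫ τ in t₀..t, g₀ τ) l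
      (Icc t₀ T))
    {Tstar : EReal} {u₀ : ℝ → L2 d} {Tmax : ι → EReal} {u : ι → ℝ → L2 d}
    (hu₀ : IsMaximalNLSSolution σ α g₀ t₀ (sobolevEmb hs a) Tstar u₀)
    (hT : (T : EReal) < Tstar)
    (hu : ∀ᶠ i in l, IsMaximalNLSSolution σ α (g i) t₀ (sobolevEmb hs a) (Tmax i) (u i)) :
    (∀ᶠ i in l, (T : EReal) < Tmax i) ∧
      Tendsto (fun i => ⨆ t ∈ Icc t₀ T, hsNorm σ (u i t - u₀ t)) l (𝓝 0) := by
  obtain ⟨c, huc⟩ := exists_eqOn_fromInteraction hs g₀ t₀ hu₀.isSolution.mem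
  have hc := ((isMaximalNLSSolution_iff_isMaximalIntegralSolution hN.continuous hNα hg₀ huc).mp
    hu₀).isSolution_Icc hT
  choose! b hub using fun i (hi : IsMaximalNLSSolution σ α (g i) t₀ (sobolevEmb hs a) (Tmax i)
    (u i)) => exists_eqOn_fromInteraction hs (g i) t₀ hi.isSolution.mem
  obtain ⟨hTmax, hbc⟩ := eventually_coe_lt_and_tendstoUniformlyOn_interaction
    isIsometryGroup_schrodingerMul (.lipschitz_comp (lipschitzWith_smul Complex.I) hN)
    (fun i => intervalIntegral.continuous_primitive (hg i) t₀)
    (intervalIntegral.continuous_primitive hg₀ t₀) hlim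
    (hu.mono fun i hi => (isMaximalNLSSolution_iff_isMaximalIntegralSolution hN.continuous hNα
      (hg i) (hub i hi)).mp hi) hc
  refine ⟨hTmax, (tendsto_iSup_edist_of_tendstoUniformlyOn hbc).congr' ?_⟩
  filter_upwards [hu, hTmax] with i hi hTi
  refine biSup_congr fun t ht => ?_
  rw [huc (Icc_subset_setOf_coe_lt hT ht), hub i hi (Icc_subset_setOf_coe_lt hTi ht),
    fromInteraction, fromInteraction, hsNorm_sobolevEmb_sub]

end SobolevSolutions

section Averaging

theorem periodic_dispersionMap (γp γm tp : ℝ) :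
    Function.Periodic (dispersionMap γp γm tp) 1 := fun τ => by
  have hrep : τ + 1 - (⌈τ + 1⌉ : ℝ) + 1 = τ - ⌈τ⌉ + 1 := by
    rw [Int.ceil_add_one]
    push_cast
    ring
  rw [dispersionMap, dispersionMap, hrep]

theorem intervalIntegrable_dispersionMap (γp γm tp a b : ℝ) :
    IntervalIntegrable (dispersionMap γp γm tp) volume a b := by
  have hrep : Measurable fun τ : ℝ => τ - ⌈τ⌉ + 1 := by fun_prop
  have hmeas : Measurable (dispersionMap γp γm tp) :=
    Measurable.ite (measurableSet_le hrep measurable_const) measurable_const measurable_const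
  refine (intervalIntegrable_const (c := max |γp| |γm|)).mono_fun hmeas.aestronglyMeasurable
    (.of_forall fun τ => ?_)
  have hle : |dispersionMap γp γm tp τ| ≤ max |γp| |γm| := by
    rw [dispersionMap]
    split_ifs <;> simp
  exact hle.trans (le_abs_self _)

variable {γ : ℝ → ℝ}

theorem exists_abs_integral_sub_averageDispersion_le (hγ : Function.Periodic γ 1)
    (hγi : ∀ a b, IntervalIntegrable γ volume a b) :
    ∃ B : ℝ, ∀ x y, |∫ τ in x..y, (γ τ - averageDispersion γ)| ≤ B := by
  have hi (x y : ℝ) : IntervalIntegrable (fun τ => γ τ - averageDispersion γ) volume x y :=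
    (hγi x y).sub intervalIntegrable_const
  have hmean : ∫ τ in (0 : ℝ)..0 + 1, (γ τ - averageDispersion γ) = 0 := by
    rw [zero_add, intervalIntegral.integral_sub (hγi 0 1) intervalIntegrable_const]
    simp [averageDispersion]
  have hper : Function.Periodic (fun x => ∫ τ in (0 : ℝ)..x, (γ τ - averageDispersion γ)) 1 :=
    fun x => by
      have hadd := Function.Periodic.intervalIntegral_add_eq
        (f := fun τ => γ τ - averageDispersion γ) (T := 1) (fun τ => by simp only [hγ τ]) x 0
      simp only
      rw [← intervalIntegral.integral_add_adjacent_intervals (hi 0 x) (hi x (x + 1)), hadd, hmean,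
        add_zero]
  obtain ⟨B, hB⟩ := (hper.compact_of_continuous one_ne_zero
    (intervalIntegral.continuous_primitive hi 0)).isBounded.exists_norm_le
  refine ⟨B + B, fun x y => ?_⟩
  rw [← intervalIntegral.integral_interval_sub_left (hi 0 y) (hi 0 x)]
  exact (abs_sub _ _).trans (add_le_add (hB _ (mem_range_self y)) (hB _ (mem_range_self x)))

theorem integral_comp_div_sub_integral_averageDispersion
    (hγi : ∀ a b, IntervalIntegrable γ volume a b) {ε : ℝ} (hε : ε ≠ 0) (x y : ℝ) :
    (∫ τ in x..y, γ (τ / ε)) - ∫ _ in x..y, averageDispersion γ =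
      ε * ∫ τ in x / ε..y / ε, (γ τ - averageDispersion γ) := by
  rw [intervalIntegral.integral_comp_div γ hε,
    intervalIntegral.integral_sub (hγi _ _) intervalIntegrable_const]
  simp only [intervalIntegral.integral_const, smul_eq_mul]
  field_simp

theorem tendstoUniformlyOn_integral_comp_div (hγ : Function.Periodic γ 1)
    (hγi : ∀ a b, IntervalIntegrable γ volume a b) (t₀ : ℝ) (J : Set ℝ) :
    TendstoUniformlyOn (fun ε t => ∫ τ in t₀..t, γ (τ / ε))
      (fun t => ∫ _ in t₀..t, averageDispersion γ) (𝓝[>] 0) J := by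
  obtain ⟨B, hB⟩ := exists_abs_integral_sub_averageDispersion_le hγ hγi
  have hεB : Tendsto (fun ε : ℝ => ε * B) (𝓝[>] 0) (𝓝 0) := by
    simpa using (tendsto_id.mul_const B).mono_left (nhdsWithin_le_nhds (a := (0 : ℝ)))
  refine Metric.tendstoUniformlyOn_iff.mpr fun η hη => ?_
  filter_upwards [hεB.eventually (Iio_mem_nhds hη), self_mem_nhdsWithin] with ε hlt hε t _
  have hε : 0 < ε := hε
  rw [dist_comm, Real.dist_eq, integral_comp_div_sub_integral_averageDispersion hγi hε.ne',
    abs_mul, abs_of_pos hε]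
  exact (mul_le_mul_of_nonneg_left (hB _ _) hε.le).trans_lt hlt

theorem intervalIntegrable_comp_div (hγi : ∀ a b, IntervalIntegrable γ volume a b) (ε x y : ℝ) :
    IntervalIntegrable (fun τ => γ (τ / ε)) volume x y := by
  rcases eq_or_ne ε 0 with rfl | hε
  · simp
  · simpa [div_eq_mul_inv, hε] using (hγi (x * ε⁻¹) (y * ε⁻¹)).comp_mul_right (c := ε⁻¹)

end Averaging

theorem mainTheorem6_general (d σ α : ℕ) (hσ : (d : ℝ) / 2 < σ) (γ : ℝ → ℝ)
    (hγ : Function.Periodic γ 1) (hγi : IntervalIntegrable γ volume 0 1)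
    (t₀ : ℝ) (φ : L2 d) (hφ : MemHs σ φ) :
    HasUniqueMaximalNLSSolution σ α (fun _ => averageDispersion γ) t₀ φ ∧
    (∀ ε : ℝ, 0 < ε → HasUniqueMaximalNLSSolution σ α (fun t => γ (t / ε)) t₀ φ) ∧
    ∀ (Tstar : EReal) (u₀ : ℝ → L2 d) (Tmax : ℝ → EReal) (u : ℝ → ℝ → L2 d),
      IsMaximalNLSSolution σ α (fun _ => averageDispersion γ) t₀ φ Tstar u₀ →
      (∀ ε : ℝ, 0 < ε → IsMaximalNLSSolution σ α (fun t => γ (t / ε)) t₀ φ (Tmax ε) (u ε)) →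
      ∀ T : ℝ, (T : EReal) < Tstar →
        (∀ᶠ ε in 𝓝[>] (0 : ℝ), (T : EReal) < Tmax ε) ∧
        Tendsto (fun ε => ⨆ t ∈ Set.Icc t₀ T, hsNorm σ (u ε t - u₀ t))
          (𝓝[>] (0 : ℝ)) (𝓝 0) := by
  have hs : (0 : ℝ) ≤ σ := Nat.cast_nonneg σ
  obtain ⟨N, hN, hNα⟩ := exists_powerNL_sobolevEmb_eq hs hσ α
  obtain ⟨a, rfl⟩ := hφ.exists_sobolevEmb_eq hs
  have hγi' : ∀ x y, IntervalIntegrable γ volume x y := hγ.intervalIntegrable₀ one_ne_zero hγi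
  refine ⟨hasUniqueMaximalNLSSolution_of_isLipschitzOnBalls hN hNα
      fun _ _ => intervalIntegrable_const,
    fun ε _ => hasUniqueMaximalNLSSolution_of_isLipschitzOnBalls hN hNα
      (intervalIntegrable_comp_div hγi' ε), fun Tstar u₀ Tmax u hu₀ hu T hT => ?_⟩
  exact eventually_coe_lt_and_tendsto_iSup_hsNorm_sub hN hNα (fun _ _ => intervalIntegrable_const)
    (intervalIntegrable_comp_div hγi') (tendstoUniformlyOn_integral_comp_div hγ hγi' t₀ _) hu₀ hT
    (eventually_mem_nhdsWithin.mono hu)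

theorem mainTheorem6 (d σ α : ℕ) (hd : 1 ≤ d) (hσ : (d : ℝ) / 2 < σ) (hα : 1 ≤ α)
    (γp γm tp : ℝ) (hγp : 0 < γp) (hγm : 0 < γm) (htp : tp ∈ Set.Ioo (0 : ℝ) 1)
    (t₀ : ℝ) (φ : L2 d) (hφ : MemHs σ φ) :
    HasUniqueMaximalNLSSolution σ α
      (fun _ => averageDispersion (dispersionMap γp γm tp)) t₀ φ ∧
    (∀ ε : ℝ, 0 < ε →
      HasUniqueMaximalNLSSolution σ α (fun t => dispersionMap γp γm tp (t / ε)) t₀ φ) ∧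
    ∀ (Tstar : EReal) (u₀ : ℝ → L2 d) (Tmax : ℝ → EReal) (u : ℝ → ℝ → L2 d),
      IsMaximalNLSSolution σ α
        (fun _ => averageDispersion (dispersionMap γp γm tp)) t₀ φ Tstar u₀ →
      (∀ ε : ℝ, 0 < ε → IsMaximalNLSSolution σ α
        (fun t => dispersionMap γp γm tp (t / ε)) t₀ φ (Tmax ε) (u ε)) →
      ∀ T : ℝ, t₀ < T → (T : EReal) < Tstar →
        (∀ᶠ ε in 𝓝[>] (0 : ℝ), (T : EReal) < Tmax ε) ∧
        Tendsto (fun ε => ⨆ t ∈ Set.Icc t₀ T, hsNorm σ (u ε t - u₀ t))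
          (𝓝[>] (0 : ℝ)) (𝓝 0) := by
  obtain ⟨havg, hdm, hlim⟩ := mainTheorem6_general d σ α hσ _ (periodic_dispersionMap γp γm tp)
    (intervalIntegrable_dispersionMap γp γm tp 0 1) t₀ φ hφ
  exact ⟨havg, hdm, fun Tstar u₀ Tmax u hu₀ hu T _ => hlim Tstar u₀ Tmax u hu₀ hu T⟩
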